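/- For a diffeological space $Y$ and $y\in Y$, let the internal tangent space $T_y(Y)$ be the colimit, in real vector spaces, of $T_0(U)$ over all plots $p:U\to Y$ with $U$ a connected open neighbourhood of $0$ in some $\mathbb{R}^m$ and $p(0)=y$ (morphisms being smooth maps over $Y$ fixing $0$). Let $TY=\coprod_{y\in Y}T_y(Y)$ with projection $\pi_Y:TY\to Y$. Hector's diffeology on $TY$ is the one generated by the maps $Tf:TU\to TY$ for plots $f:U\to Y$ with $U$ a connected open subset of a Euclidean space, and the dvs diffeology is the smallest diffeology containing Hector's which makes $TY$ into a diffeological vector space over $Y$ (a smooth map with vector space structures on its fibres such that fibrewise addition, scalar multiplication and the zero section are smooth). Function spaces $C^\infty(X,Y)$ carry the functional diffeology and products carry the product diffeology. Let $n\in\mathbb{N}$. (a) Let $X$ be a diffeological space. On $T\mathbb{R}^n$ and on $T(C^\infty(X,\mathbb{R}^n))$, Hector's diffeology and the dvs diffeology coincide. With this diffeology, $T(C^\infty(X,\mathbb{R}^n))$ is a diffeological vector space over $C^\infty(X,\mathbb{R}^n)$; so is $C^\infty(X,T\mathbb{R}^n)$, via $(\pi_{\mathbb{R}^n})_*$ and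 pointwise operations; and the natural map $$\gamma:T(C^\infty(X,\mathbb{R}^n))\to C^\infty(X,T\mathbb{R}^n),\qquad \gamma(f,v)(x)=\bigl(f(x),(\mathrm{ev}_x)_*v\bigr),$$ where $\mathrm{ev}_x:C^\infty(X,\mathbb{R}^n)\to\mathbb{R}^n$ is evaluation at $x$, is an isomorphism of diffeological vector spaces over $C^\infty(X,\mathbb{R}^n)$: it is a diffeomorphism, commutes with the projections to $C^\infty(X,\mathbb{R}^n)$, and is linear on each fibre. (b) In particular, let $J$ be any set. Hector's diffeology and the dvs diffeology coincide on $T(\prod_{j\in J}\mathbb{R}^n)$, both $T(\prod_{j\in J}\mathbb{R}^n)$ and $\prod_{j\in J}T\mathbb{R}^n$ are diffeological vector spaces over $\prod_{j\in J}\mathbb{R}^n$, and the natural map $$T\Bigl(\prod_{j\in J}\mathbb{R}^n\Bigr)\to\prod_{j\in J}T\mathbb{R}^n,\qquad (x,v)\mapsto\bigl(x_j,(\mathrm{pr}_j)_*v\bigr)_{j\in J},$$ is an isomorphism of diffeological vector spaces over $\prod_{j\in J}\mathbb{R}^n$. -/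

import Mathlib

open scoped ContDiff DirectSum

namespace Diffeology

/-- The model space `ℝⁿ`. -/
abbrev Euc (n : ℕ) : Type := EuclideanSpace ℝ (Fin n)

/-! ### Standard constructions of diffeologies -/

/-- The pullback diffeology: the largest diffeology on `V` for which `π : V → B` is smooth. -/
@[reducible] def inducedDiffeology {V B : Type*} (π : V → B) [DiffeologicalSpace B] :
    DiffeologicalSpace V where
  plots _ := {p | IsPlot (π ∘ p)}
  constant_plots x := isPlot_const (x := π x)
  plot_reparam {_ _ p _} hp hf := isPlot_reparam (p := π ∘ p) hp hf
  locality {_ p} h := DiffeologicalSpace.locality (p := π ∘ p) h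

/-- The sub-diffeology. For an open subset `U` of `ℝⁿ` and a diffeological space `X`, a plot
`U → X` is the same thing as a smooth map `U → X`, where `U` has the sub-diffeology. -/
instance {X : Type*} [DiffeologicalSpace X] {P : X → Prop} : DiffeologicalSpace (Subtype P) :=
  inducedDiffeology Subtype.val

/-- The product diffeology on a binary product. -/
instance {X Y : Type*} [DiffeologicalSpace X] [DiffeologicalSpace Y] :
    DiffeologicalSpace (X × Y) where
  plots _ := {p | IsPlot (fun t => (p t).1) ∧ IsPlot (fun t => (p t).2)}
  constant_plots _ := ⟨isPlot_const, isPlot_const⟩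
  plot_reparam hp hf := ⟨isPlot_reparam hp.1 hf, isPlot_reparam hp.2 hf⟩
  locality {n p} h :=
    ⟨DiffeologicalSpace.locality (p := fun t => (p t).1) fun x =>
      let ⟨u, hu, hx, H⟩ := h x; ⟨u, hu, hx, fun hf hs => (H hf hs).1⟩,
     DiffeologicalSpace.locality (p := fun t => (p t).2) fun x =>
      let ⟨u, hu, hx, H⟩ := h x; ⟨u, hu, hx, fun hf hs => (H hf hs).2⟩⟩

/-- The product diffeology on an arbitrary product. -/
instance {J : Type*} {Y : J → Type*} [∀ j, DiffeologicalSpace (Y j)] :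
    DiffeologicalSpace (∀ j, Y j) where
  plots _ := {p | ∀ j, IsPlot (fun t => p t j)}
  constant_plots _ := fun _ => isPlot_const
  plot_reparam hp hf := fun j => isPlot_reparam (hp j) hf
  locality {n p} h := fun j =>
    DiffeologicalSpace.locality (p := fun t => p t j) fun x =>
      let ⟨u, hu, hx, H⟩ := h x; ⟨u, hu, hx, fun hf hs => (H hf hs) j⟩

/-- `C^∞(X, Y)`, the set of smooth maps between two diffeological spaces. -/
@[ext] structure SmoothMap (X Y : Type*) [DiffeologicalSpace X] [DiffeologicalSpace Y] where
  toFun : X → Y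
  smooth : DSmooth toFun

instance {X Y : Type*} [DiffeologicalSpace X] [DiffeologicalSpace Y] :
    CoeFun (SmoothMap X Y) (fun _ => X → Y) := ⟨SmoothMap.toFun⟩

/-- The functional diffeology: `p : ℝᵏ → C^∞(X, Y)` is a plot iff its adjoint
`ℝᵏ × X → Y` is smooth. -/
instance {X Y : Type*} [DiffeologicalSpace X] [DiffeologicalSpace Y] :
    DiffeologicalSpace (SmoothMap X Y) where
  plots k := {p | DSmooth (fun z : Euc k × X => p z.1 z.2)}
  constant_plots f := fun m q hq => f.smooth m _ hq.2
  plot_reparam {n m p f} hp hf := fun k q hq =>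
    hp k (fun t => (f (q t).1, (q t).2)) ⟨(hf.comp hq.1.contDiff).isPlot, hq.2⟩
  locality {n p} h := fun k q hq => DiffeologicalSpace.locality fun t => by
    obtain ⟨u, hu, hx, H⟩ := h (q t).1
    refine ⟨(fun s => (q s).1) ⁻¹' u, hu.preimage hq.1.contDiff.continuous, hx, ?_⟩
    intro m f hf hs
    have h1 := H (f := fun s => (q (f s)).1) hf (hq.1.contDiff.comp hs)
    exact h1 m (fun s => (s, (q (f s)).2)) ⟨isPlot_id', isPlot_reparam hq.2 hs⟩

/-- Evaluation at a point. -/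
abbrev SmoothMap.eval {X Y : Type*} [DiffeologicalSpace X] [DiffeologicalSpace Y] (x : X)
    (f : SmoothMap X Y) : Y := f x

theorem SmoothMap.dSmooth_eval {X Y : Type*} [DiffeologicalSpace X] [DiffeologicalSpace Y]
    (x : X) : DSmooth (SmoothMap.eval x : SmoothMap X Y → Y) :=
  fun n _ hp => hp n (fun t => (t, x)) ⟨isPlot_id', isPlot_const⟩

/-! ### The internal tangent space -/

/-- An object of the category of plots of `X` centred at `x`: a plot `p : U → X` with `U` a
connected open neighbourhood of `0` in some `ℝⁿ` and `p 0 = x`. -/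
structure CenteredPlot (X : Type*) [DiffeologicalSpace X] (x : X) where
  dim : ℕ
  dom : Set (Euc dim)
  isOpen_dom : IsOpen dom
  isConnected_dom : IsConnected dom
  zero_mem : (0 : Euc dim) ∈ dom
  toFun : dom → X
  smooth : DSmooth toFun
  map_zero : toFun ⟨0, zero_mem⟩ = x

/-- A morphism `p → q` of centred plots: a smooth map `f : U → V` with `f 0 = 0` and
`q ∘ f = p`. Only the values of `f` on the domain `U` of `p` matter. -/
structure IsCenteredHom {X : Type*} [DiffeologicalSpace X] {x y : X}
    (p : CenteredPlot X x) (q : CenteredPlot X y) (f : Euc p.dim → Euc q.dim) : Prop where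
  contDiffOn : ContDiffOn ℝ ∞ f p.dom
  mapsTo : Set.MapsTo f p.dom q.dom
  map_zero : f 0 = 0
  comm : ∀ u : p.dom, q.toFun ⟨f u, mapsTo u.2⟩ = p.toFun u

open Classical in
/-- The relations `p_*(u) = q_*(f_* u)` defining the colimit over the category of centred plots;
here `T₀(U) = ℝⁿ` and `f_*` is the derivative of `f` at `0`. -/
def tangentRelations (X : Type*) [DiffeologicalSpace X] (x : X) :
    Submodule ℝ (⨁ p : CenteredPlot X x, Euc p.dim) :=
  Submodule.span ℝ {z | ∃ (p q : CenteredPlot X x) (f : Euc p.dim → Euc q.dim) (u : Euc p.dim),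
    IsCenteredHom p q f ∧
    z = DirectSum.lof ℝ _ (fun p : CenteredPlot X x => Euc p.dim) p u -
      DirectSum.lof ℝ _ (fun p : CenteredPlot X x => Euc p.dim) q (fderiv ℝ f 0 u)}

/-- The internal tangent space `T_x(X)`: the colimit, in real vector spaces, of `T₀(U)` over all
plots `U → X` centred at `x`. -/
def InternalTangentSpace (X : Type*) [DiffeologicalSpace X] (x : X) : Type _ :=
  (⨁ p : CenteredPlot X x, Euc p.dim) ⧸ tangentRelations X x

noncomputable section

instance (X : Type*) [DiffeologicalSpace X] (x : X) : AddCommGroup (InternalTangentSpace X x) :=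
  inferInstanceAs (AddCommGroup ((⨁ p : CenteredPlot X x, Euc p.dim) ⧸ tangentRelations X x))

instance (X : Type*) [DiffeologicalSpace X] (x : X) : Module ℝ (InternalTangentSpace X x) :=
  inferInstanceAs (Module ℝ ((⨁ p : CenteredPlot X x, Euc p.dim) ⧸ tangentRelations X x))

namespace CenteredPlot

variable {X : Type*} [DiffeologicalSpace X] {x : X}

open Classical in
/-- `p_* : T₀(U) → T_x(X)`, the structure map of the colimit. -/
def push (p : CenteredPlot X x) : Euc p.dim →ₗ[ℝ] InternalTangentSpace X x :=
  (tangentRelations X x).mkQ ∘ₗ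
    DirectSum.lof ℝ _ (fun p : CenteredPlot X x => Euc p.dim) p

theorem push_eq {p q : CenteredPlot X x} {f : Euc p.dim → Euc q.dim} (hf : IsCenteredHom p q f)
    (u : Euc p.dim) : p.push u = q.push (fderiv ℝ f 0 u) :=
  (Submodule.Quotient.eq _).2 (Submodule.subset_span ⟨p, q, f, u, hf, rfl⟩)

end CenteredPlot

namespace InternalTangentSpace

variable {X : Type*} [DiffeologicalSpace X] {x : X}

open Classical in
/-- Existence part of the universal property of the colimit. -/
def desc {M : Type*} [AddCommGroup M] [Module ℝ M]
    (φ : ∀ p : CenteredPlot X x, Euc p.dim →ₗ[ℝ] M)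
    (hφ : ∀ (p q : CenteredPlot X x) (f : Euc p.dim → Euc q.dim), IsCenteredHom p q f →
      ∀ u, φ p u = φ q (fderiv ℝ f 0 u)) :
    InternalTangentSpace X x →ₗ[ℝ] M :=
  (tangentRelations X x).liftQ (DirectSum.toModule ℝ _ M φ) <| by
    rw [tangentRelations, Submodule.span_le]
    rintro _ ⟨p, q, f, u, hf, rfl⟩
    simp [DirectSum.toModule_lof, hφ p q f hf u]

open Classical in
theorem desc_push {M : Type*} [AddCommGroup M] [Module ℝ M]
    (φ : ∀ p : CenteredPlot X x, Euc p.dim →ₗ[ℝ] M)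
    (hφ : ∀ (p q : CenteredPlot X x) (f : Euc p.dim → Euc q.dim), IsCenteredHom p q f →
      ∀ u, φ p u = φ q (fderiv ℝ f 0 u)) (p : CenteredPlot X x) (u : Euc p.dim) :
    desc φ hφ (p.push u) = φ p u :=
  DirectSum.toModule_lof (φ := φ) ℝ p u

open Classical in
/-- Every internal tangent vector is a finite sum of vectors `p_*(u)`. -/
theorem induction {C : InternalTangentSpace X x → Prop} (zero : C 0)
    (push : ∀ (p : CenteredPlot X x) (u : Euc p.dim), C (p.push u))
    (add : ∀ v w, C v → C w → C (v + w)) (v : InternalTangentSpace X x) : C v := by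
  obtain ⟨z, rfl⟩ := (tangentRelations X x).mkQ_surjective v
  induction z using DirectSum.induction_on with
  | zero => exact zero
  | of p u => exact push p u
  | add a b ha hb => exact add _ _ ha hb

end InternalTangentSpace

/-- Composition of a centred plot with a smooth map. -/
def CenteredPlot.comp {X Y : Type*} [DiffeologicalSpace X] [DiffeologicalSpace Y] {x : X}
    (p : CenteredPlot X x) (f : X → Y) (hf : DSmooth f) : CenteredPlot Y (f x) where
  dim := p.dim
  dom := p.dom
  isOpen_dom := p.isOpen_dom
  isConnected_dom := p.isConnected_dom
  zero_mem := p.zero_mem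
  toFun := f ∘ p.toFun
  smooth := hf.comp p.smooth
  map_zero := congrArg f p.map_zero

/-- The linear map `f_* : T_x(X) → T_{f(x)}(Y)` induced by a smooth map `f`; it sends `p_*(u)` to
`(f ∘ p)_*(u)`. -/
def tangentMap {X Y : Type*} [DiffeologicalSpace X] [DiffeologicalSpace Y]
    (f : X → Y) (hf : DSmooth f) (x : X) :
    InternalTangentSpace X x →ₗ[ℝ] InternalTangentSpace Y (f x) :=
  InternalTangentSpace.desc (fun p => (p.comp f hf).push) fun p q g hg u =>
    CenteredPlot.push_eq (p := p.comp f hf) (q := q.comp f hf) (f := g)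
      ⟨hg.contDiffOn, hg.mapsTo, hg.map_zero, fun u => congrArg f (hg.comm u)⟩ u

/-! ### Diffeological vector spaces over a diffeological space -/

/-- The fibre of `π` over `b`. -/
@[ext] structure Fibre {V B : Type*} (π : V → B) (b : B) where
  val : V
  proj_eq : π val = b

/-- A real vector space structure on each fibre of `π`. -/
class FibrewiseModule {V B : Type*} (π : V → B) where
  addCommGroup : ∀ b, AddCommGroup (Fibre π b)
  module : ∀ b, Module ℝ (Fibre π b)

attribute [reducible, instance] FibrewiseModule.addCommGroup FibrewiseModule.module

/-- `π : V → B` is a diffeological vector space over `B`. -/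
class IsDVSOver {V B : Type*} [DiffeologicalSpace V] [DiffeologicalSpace B] (π : V → B)
    [FibrewiseModule π] : Prop where
  dSmooth_proj : DSmooth π
  dSmooth_add : DSmooth (fun z : {z : V × V // π z.1 = π z.2} =>
    ((⟨z.1.1, z.2⟩ : Fibre π (π z.1.2)) + (⟨z.1.2, rfl⟩ : Fibre π (π z.1.2))).val)
  dSmooth_smul : DSmooth (fun z : ℝ × V => (z.1 • (⟨z.2, rfl⟩ : Fibre π (π z.2))).1)
  dSmooth_zero : DSmooth (fun b : B => (0 : Fibre π b).1)

/-- `φ : V → W` is an isomorphism from `π : V → B` to `ρ : W → B` of diffeological vector spaces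
over `B`: a diffeomorphism over `B` which is linear on each fibre. -/
structure IsDVSIso {V W B : Type*} [DiffeologicalSpace V] [DiffeologicalSpace W]
    (π : V → B) (ρ : W → B) [FibrewiseModule π] [FibrewiseModule ρ] (φ : V → W) : Prop where
  comm : ∀ v, ρ (φ v) = π v
  linear : ∀ b, IsLinearMap ℝ
    (fun v : Fibre π b => (⟨φ v.1, (comm v.1).trans v.2⟩ : Fibre ρ b))
  dSmooth : DSmooth φ
  inverse : ∃ ψ : W → V, DSmooth ψ ∧ Function.LeftInverse ψ φ ∧ Function.RightInverse ψ φ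

/-! ### The internal tangent bundle -/

/-- The internal tangent bundle `TX = ∐ₓ T_x(X)`. -/
def InternalTangentBundle (X : Type*) [DiffeologicalSpace X] : Type _ :=
  Σ x : X, InternalTangentSpace X x

namespace InternalTangentBundle

variable {X : Type*} [DiffeologicalSpace X]

/-- The element `(x, v)` of `TX`. -/
def mk (x : X) (v : InternalTangentSpace X x) : InternalTangentBundle X := ⟨x, v⟩

/-- The projection `π_X : TX → X`. -/
def proj (v : InternalTangentBundle X) : X := v.1

/-- The fibre of `TX → X` over `x` is `T_x(X)`. -/
def fibreEquiv (x : X) :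
    Fibre (proj : InternalTangentBundle X → X) x ≃ InternalTangentSpace X x where
  toFun | ⟨⟨_, w⟩, rfl⟩ => w
  invFun w := ⟨⟨x, w⟩, rfl⟩
  left_inv := by rintro ⟨⟨_, w⟩, rfl⟩; rfl
  right_inv _ := rfl

instance : FibrewiseModule (proj : InternalTangentBundle X → X) where
  addCommGroup x := (fibreEquiv x).addCommGroup
  module x :=
    letI := (fibreEquiv x).addCommGroup
    (fibreEquiv x).module ℝ

end InternalTangentBundle

/-- For a plot `f : U → X` and `u ∈ U`, the plot `w ↦ f (w + u)` on `U - u`, centred at `f u`. -/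
def translatedPlot {X : Type*} [DiffeologicalSpace X] {n : ℕ} {U : Set (Euc n)} (hU : IsOpen U)
    (hc : IsConnected U) (f : U → X) (hf : DSmooth f) (u : U) : CenteredPlot X (f u) where
  dim := n
  dom := {w | w + u ∈ U}
  isOpen_dom := hU.preimage (continuous_add_const (u : Euc n))
  isConnected_dom := by
    have h := hc.image (fun w => w - (u : Euc n)) (continuous_id.sub continuous_const).continuousOn
    convert! h using 1
    ext w
    simp only [Set.mem_ofPred_eq, Set.mem_image]
    exact ⟨fun h => ⟨_, h, by simp⟩, by rintro ⟨y, hy, rfl⟩; simpa using hy⟩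
  zero_mem := by simp
  toFun w := f ⟨w + u, w.2⟩
  smooth := fun m p hp => hf m (fun t => ⟨(p t : Euc n) + u, (p t).2⟩) <| by
    have h : ContDiff ℝ ∞ (fun t => (p t : Euc n)) := IsPlot.contDiff hp
    exact (h.add contDiff_const).isPlot
  map_zero := by simp

/-- For a plot `f : U → X`, the map `Tf : TU → TX`, where `TU = U × ℝⁿ`. -/
def plotTangentMap {X : Type*} [DiffeologicalSpace X] {n : ℕ} {U : Set (Euc n)} (hU : IsOpen U)
    (hc : IsConnected U) (f : U → X) (hf : DSmooth f) (z : U × Euc n) : InternalTangentBundle X :=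
  .mk (f z.1) ((translatedPlot hU hc f hf z.1).push z.2)

/-- Hector's diffeology on `TX`: it is generated by the maps `Tf : TU → TX`, for all plots
`f : U → X` with `U` connected. -/
@[reducible] def hectorDiffeology (X : Type*) [DiffeologicalSpace X] :
    DiffeologicalSpace (InternalTangentBundle X) :=
  DiffeologicalSpace.generateFrom {s | ∃ (n : ℕ) (U : Set (Euc n)) (hU : IsOpen U)
    (hc : IsConnected U) (f : U → X) (hf : DSmooth f) (g : Euc s.1 → U × Euc n),
    IsPlot g ∧ s.2 = plotTangentMap hU hc f hf ∘ g}

/-- The dvs diffeology on `TX`: the smallest diffeology containing Hector's diffeology which makes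
`TX` into a diffeological vector space over `X`. -/
@[reducible] def dvsDiffeology (X : Type*) [DiffeologicalSpace X] :
    DiffeologicalSpace (InternalTangentBundle X) :=
  sInf {d | hectorDiffeology X ≤ d ∧
    @IsDVSOver (InternalTangentBundle X) X d _ InternalTangentBundle.proj _}

/-- The internal tangent bundle carries the dvs diffeology, unless indicated otherwise. -/
instance (X : Type*) [DiffeologicalSpace X] : DiffeologicalSpace (InternalTangentBundle X) :=
  dvsDiffeology X

theorem hector_le_dvs (X : Type*) [DiffeologicalSpace X] : hectorDiffeology X ≤ dvsDiffeology X :=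
  le_sInf fun _ hd => hd.1

theorem hector_le_induced (X : Type*) [DiffeologicalSpace X] :
    hectorDiffeology X ≤ inducedDiffeology (InternalTangentBundle.proj (X := X)) := by
  rw [DiffeologicalSpace.generateFrom_le_iff]
  rintro n p ⟨m, U, hU, hc, f, hf, g, hg, h⟩
  have h' := hf n (fun t => (g t).1) hg.1
  rw [show p = plotTangentMap hU hc f hf ∘ g from h]
  exact h'

theorem isDVSOver_induced (X : Type*) [DiffeologicalSpace X] :
    @IsDVSOver (InternalTangentBundle X) X (inducedDiffeology InternalTangentBundle.proj) _
      InternalTangentBundle.proj _ := by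
  let _ : DiffeologicalSpace (InternalTangentBundle X) :=
    inducedDiffeology InternalTangentBundle.proj
  refine @IsDVSOver.mk _ _ (_) _ _ _ ?_ ?_ ?_ ?_
  · exact fun n p hp => hp
  · intro n p hp
    have h : IsPlot (fun t => (p t).1.2.proj) := hp.2
    show IsPlot (fun t => InternalTangentBundle.proj _)
    convert! h using 2 with t
  · intro n p hp
    have h : IsPlot (fun t => (p t).2.proj) := hp.2
    show IsPlot (fun t => InternalTangentBundle.proj _)
    convert! h using 2 with t
  · intro n p hp
    show IsPlot (fun t => InternalTangentBundle.proj _)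
    convert! hp using 2 with t

/-- The dvs diffeology does make `TX` into a diffeological vector space over `X`. -/
instance (X : Type*) [DiffeologicalSpace X] :
    IsDVSOver (InternalTangentBundle.proj : InternalTangentBundle X → X) where
  dSmooth_proj := fun _ _ hp => DiffeologicalSpace.isPlot_sInf_iff.1 hp _
    ⟨hector_le_induced X, isDVSOver_induced X⟩
  dSmooth_add := fun n p hp => DiffeologicalSpace.isPlot_sInf_iff.2 fun d hd =>
    (@IsDVSOver.dSmooth_add _ _ d _ _ _ hd.2) n p
      ⟨DiffeologicalSpace.isPlot_sInf_iff.1 hp.1 d hd,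
        DiffeologicalSpace.isPlot_sInf_iff.1 hp.2 d hd⟩
  dSmooth_smul := fun n p hp => DiffeologicalSpace.isPlot_sInf_iff.2 fun d hd =>
    (@IsDVSOver.dSmooth_smul _ _ d _ _ _ hd.2) n p
      ⟨hp.1, DiffeologicalSpace.isPlot_sInf_iff.1 hp.2 d hd⟩
  dSmooth_zero := fun n p hp => DiffeologicalSpace.isPlot_sInf_iff.2 fun d hd =>
    (@IsDVSOver.dSmooth_zero _ _ d _ _ _ hd.2) n p hp

/-! ### Function spaces and products of diffeological vector spaces over a base -/

section FunctionSpace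

variable {V B : Type*} [DiffeologicalSpace V] [DiffeologicalSpace B] (π : V → B)
  [FibrewiseModule π] [IsDVSOver π] (X : Type*) [DiffeologicalSpace X]

/-- The map `π_* : C^∞(X, V) → C^∞(X, B)`. -/
def postcomp (g : SmoothMap X V) : SmoothMap X B := ⟨π ∘ g, IsDVSOver.dSmooth_proj.comp g.smooth⟩

variable {X}

/-- The smooth sections of `π` along `f : X → B`, with pointwise operations. -/
def smoothSections (f : SmoothMap X B) : Submodule ℝ (∀ x, Fibre π (f x)) where
  carrier := {s | DSmooth fun x => (s x).1}
  zero_mem' := (IsDVSOver.dSmooth_zero (π := π)).comp f.smooth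
  add_mem' {s t} hs ht := by
    have h : DSmooth (fun x => (⟨((s x).1, (t x).1), (s x).2.trans (t x).2.symm⟩ :
        {z : V × V // π z.1 = π z.2})) := fun n p hp => ⟨hs n p hp, ht n p hp⟩
    have key : ∀ (b : B) (v w : Fibre π b), (v + w).1 =
        ((⟨v.1, v.2.trans w.2.symm⟩ : Fibre π (π w.1)) + (⟨w.1, rfl⟩ : Fibre π (π w.1))).1 := by
      rintro b v ⟨w, rfl⟩; rfl
    have e := (IsDVSOver.dSmooth_add (π := π)).comp h
    have e' : (fun x => ((s + t) x).val) = _ := funext fun x => key _ (s x) (t x)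
    exact (congrArg DSmooth e').mpr e
  smul_mem' c s hs := by
    have h : DSmooth (fun x => (c, (s x).1)) := fun n p hp => ⟨isPlot_const, hs n p hp⟩
    have key : ∀ (b : B) (v : Fibre π b),
        (c • v).1 = (c • (⟨v.1, rfl⟩ : Fibre π (π v.1))).1 := by
      rintro b ⟨v, rfl⟩; rfl
    have e := (IsDVSOver.dSmooth_smul (π := π)).comp h
    have e' : (fun x => ((c • s) x).val) = _ := funext fun x => key _ (s x)
    exact (congrArg DSmooth e').mpr e

/-- The fibre of `π_*` over `f` is the set of smooth sections of `π` along `f`. -/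
def fibrePostcompEquiv (f : SmoothMap X B) : Fibre (postcomp π X) f ≃ smoothSections π f where
  toFun g := ⟨fun x => ⟨g.1 x, congrFun (congrArg SmoothMap.toFun g.2) x⟩, g.1.smooth⟩
  invFun s := ⟨⟨fun x => (s.1 x).1, s.2⟩, SmoothMap.ext (funext fun x => (s.1 x).2)⟩
  left_inv _ := rfl
  right_inv _ := rfl

/-- The fibres of `π_* : C^∞(X, V) → C^∞(X, B)` are vector spaces under pointwise operations. -/
instance : FibrewiseModule (postcomp π X) where
  addCommGroup f := (fibrePostcompEquiv π f).addCommGroup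
  module f :=
    letI := (fibrePostcompEquiv π f).addCommGroup
    (fibrePostcompEquiv π f).module ℝ

end FunctionSpace

section Product

variable {V B : Type*} (π : V → B) [FibrewiseModule π] (J : Type*)

/-- The map `∏_J π : ∏_J V → ∏_J B`. -/
def powMap (v : J → V) : J → B := fun j => π (v j)

variable {J}

/-- The fibre of `∏_J π` is the product of the fibres. -/
def fibrePowEquiv (b : J → B) : Fibre (powMap π J) b ≃ ∀ j, Fibre π (b j) where
  toFun v := fun j => ⟨v.1 j, congrFun v.2 j⟩
  invFun v := ⟨fun j => (v j).1, funext fun j => (v j).2⟩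
  left_inv _ := rfl
  right_inv _ := rfl

/-- The fibres of `∏_J π` are vector spaces under componentwise operations. -/
instance : FibrewiseModule (powMap π J) where
  addCommGroup b := (fibrePowEquiv π b).addCommGroup
  module b :=
    letI := (fibrePowEquiv π b).addCommGroup
    (fibrePowEquiv π b).module ℝ

end Product

/-! ### The natural maps -/

section NaturalMaps

variable {X Y : Type*} [DiffeologicalSpace X] [DiffeologicalSpace Y]

theorem mk_push_eq {x y : X} (h : x = y) (p : CenteredPlot X x) (q : CenteredPlot X y)
    {f : Euc p.dim → Euc q.dim} (hf : IsCenteredHom p q f) (u : Euc p.dim) :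
    InternalTangentBundle.mk x (p.push u) = .mk y (q.push (fderiv ℝ f 0 u)) := by
  subst h
  rw [CenteredPlot.push_eq hf]

theorem dSmooth_gamma_push {f : SmoothMap X Y} (p : CenteredPlot (SmoothMap X Y) f)
    (u : Euc p.dim) : DSmooth (fun x : X => InternalTangentBundle.mk (f x)
      (tangentMap (SmoothMap.eval x) (SmoothMap.dSmooth_eval x) f (p.push u))) := by
  intro m r hr
  refine DiffeologicalSpace.le_iff'.1 (hector_le_dvs Y) _ _ ?_
  let e : (Euc p.dim × Euc m) ≃L[ℝ] Euc (p.dim + m) :=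
    ContinuousLinearEquiv.ofFinrankEq (by simp)
  let W : Set (Euc (p.dim + m)) := {w | (e.symm w).1 ∈ p.dom}
  have hW : IsOpen W := p.isOpen_dom.preimage (continuous_fst.comp e.symm.continuous)
  have hc : IsConnected W := by
    have h := (p.isConnected_dom.prod (isConnected_univ (α := Euc m))).image e
      e.continuous.continuousOn
    convert! h using 1
    ext w
    simp only [W, Set.mem_ofPred_eq, Set.mem_image]
    exact ⟨fun h => ⟨e.symm w, ⟨h, trivial⟩, by simp⟩, by rintro ⟨y, hy, rfl⟩; simpa using hy.1⟩
  let F : W → Y := fun w => p.toFun ⟨(e.symm w).1, w.2⟩ (r (e.symm w).2)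
  have hF : DSmooth F := by
    intro k g hg
    have hg' : ContDiff ℝ ∞ (fun t => e.symm (g t : Euc (p.dim + m))) :=
      e.symm.contDiff.comp (IsPlot.contDiff hg)
    have h1 := p.smooth k (fun t => ⟨(e.symm (g t)).1, (g t).2⟩) (contDiff_fst.comp hg').isPlot
    exact h1 k (fun t => (t, r (e.symm (g t)).2))
      ⟨isPlot_id', isPlot_reparam hr (contDiff_snd.comp hg')⟩
  have h0 : ∀ t : Euc m, e (0, t) ∈ W := fun t => by simpa [W] using p.zero_mem
  refine DiffeologicalSpace.isPlot_generatedFrom_of_mem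
    ⟨_, W, hW, hc, F, hF, fun t => (⟨e (0, t), h0 t⟩, e (u, 0)), ⟨?_, isPlot_const⟩, ?_⟩
  · exact ContDiff.isPlot (p := fun t : Euc m => e ((0 : Euc p.dim), t))
      (e.contDiff.comp (contDiff_const.prodMk contDiff_id))
  funext (t : Euc m)
  have hp0 : ∀ h, p.toFun ⟨(e.symm (e (0, t))).1, h⟩ = f := by
    intro h
    refine Eq.trans ?_ p.map_zero
    congr 2; simp
  have hbase : f (r t) = F ⟨e (0, t), h0 t⟩ := by
    simp only [F]; rw [hp0]; simp
  let L : Euc p.dim →L[ℝ] Euc (p.dim + m) :=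
    (e : (Euc p.dim × Euc m) →L[ℝ] Euc (p.dim + m)).comp (ContinuousLinearMap.inl ℝ _ _)
  have hL : ∀ w, L w = e (w, 0) := fun w => rfl
  have hadd : ∀ w, L w + e (0, t) = e (w, t) := fun w => by rw [hL, ← map_add]; simp
  have hd0 : fderiv ℝ L 0 u = e (u, 0) := by rw [L.fderiv]; rfl
  have hm : ∀ w ∈ p.dom, L w + e (0, t) ∈ W := fun w hw => by
    rw [hadd]; simpa [W] using hw
  have key := mk_push_eq hbase (p.comp (SmoothMap.eval (r t)) (SmoothMap.dSmooth_eval (r t)))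
    (translatedPlot hW hc F hF ⟨e (0, t), h0 t⟩) (f := L)
    ⟨L.contDiff.contDiffOn, hm, map_zero L, fun w => by
      have aux : ∀ z (hz : z ∈ W), z = e (w.1, t) → F ⟨z, hz⟩ = p.toFun w (r t) := by
        rintro z hz rfl
        have h1 : (⟨(e.symm (e (w.1, t))).1, hz⟩ : p.dom) = w :=
          Subtype.ext (congrArg Prod.fst (e.symm_apply_apply (w.1, t)))
        have h2 : (e.symm (e (w.1, t))).2 = t := by rw [e.symm_apply_apply]
        simp only [F]
        rw [h1, h2]
      exact aux _ _ (hadd w.1)⟩ u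
  have key2 := key.trans (congrArg (fun z => InternalTangentBundle.mk _
    ((translatedPlot hW hc F hF ⟨e (0, t), h0 t⟩).push z)) hd0)
  have hd : tangentMap (SmoothMap.eval (r t)) (SmoothMap.dSmooth_eval (r t)) f (p.push u) =
      (p.comp (SmoothMap.eval (r t)) (SmoothMap.dSmooth_eval (r t))).push u :=
    InternalTangentSpace.desc_push _ _ p u
  show InternalTangentBundle.mk _ _ = _
  rw [hd]
  exact key2

theorem dSmooth_gamma (f : SmoothMap X Y) (v : InternalTangentSpace (SmoothMap X Y) f) :
    DSmooth (fun x : X => InternalTangentBundle.mk (f x)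
      (tangentMap (SmoothMap.eval x) (SmoothMap.dSmooth_eval x) f v)) := by
  induction v using InternalTangentSpace.induction with
  | zero =>
    have h := (smoothSections (InternalTangentBundle.proj : InternalTangentBundle Y → Y) f).zero_mem
    have e : (fun x : X => InternalTangentBundle.mk (f x)
        (tangentMap (SmoothMap.eval x) (SmoothMap.dSmooth_eval x) f 0)) =
        fun x => (0 : Fibre (InternalTangentBundle.proj (X := Y)) (f x)).val :=
      funext fun x => congrArg _ (map_zero _)
    exact e ▸ h
  | push p u => exact dSmooth_gamma_push p u
  | add v w hv hw =>
    have h := (smoothSections (InternalTangentBundle.proj : InternalTangentBundle Y → Y) f).add_mem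
      (x := fun x => ⟨_, rfl⟩) (y := fun x => ⟨_, rfl⟩) hv hw
    have e : (fun x : X => InternalTangentBundle.mk (f x)
        (tangentMap (SmoothMap.eval x) (SmoothMap.dSmooth_eval x) f (v + w))) =
        fun x => InternalTangentBundle.mk (f x)
          (tangentMap (SmoothMap.eval x) (SmoothMap.dSmooth_eval x) f v +
            tangentMap (SmoothMap.eval x) (SmoothMap.dSmooth_eval x) f w) :=
      funext fun x => congrArg _ (map_add _ _ _)
    exact e ▸ h

/-- The natural map `γ : T(C^∞(X, Y)) → C^∞(X, TY)`, `γ(f, v)(x) = (f(x), (ev_x)_* v)`. In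
particular `γ(f, p_*(d/dt))(x)` is the tangent vector at `t = 0` of the curve `t ↦ p(t)(x)`. -/
def gamma (X Y : Type*) [DiffeologicalSpace X] [DiffeologicalSpace Y]
    (z : InternalTangentBundle (SmoothMap X Y)) : SmoothMap X (InternalTangentBundle Y) where
  toFun x := .mk (z.1 x) (tangentMap (SmoothMap.eval x) (SmoothMap.dSmooth_eval x) z.1 z.2)
  smooth := dSmooth_gamma z.1 z.2

/-- The natural map `T(∏_J Y) → ∏_J TY` induced by the projections `pr_j : ∏_J Y → Y`. -/
def powTangentMap (J Y : Type*) [DiffeologicalSpace Y] (z : InternalTangentBundle (J → Y)) :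
    J → InternalTangentBundle Y :=
  fun j => .mk (z.1 j) (tangentMap (fun y : J → Y => y j) (fun n p (hp : ∀ i, IsPlot (fun t : Euc n => p t i)) => hp j) z.1 z.2)

end NaturalMaps

end

end Diffeology

/-!
For `F = C^∞(X, ℝⁿ)` or `F = ∏_J ℝⁿ` the tangent bundle is trivial: `TF ≃ F × F`, where a pair
`(f, g)` corresponds to the velocity at `s = 0` of the line `s ↦ f + s • g`. In these coordinates
the natural maps are `C^∞(X, ℝⁿ) × C^∞(X, ℝⁿ) ≃ C^∞(X, ℝⁿ × ℝⁿ)` and its analogue for powers,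
which are diffeomorphisms.

Besides smooth addition and scalar multiplication, the argument uses only two properties of `F`,
collected in `IsHadamardSpace`: smooth linear functionals separate points, and there is a smooth
map `Δ : C^∞(ℝ, F) → C^∞(ℝ, F)` with `c s = c 0 + s • Δ c s` for every smooth curve `c`. For `ℝⁿ`
this is Hadamard's lemma, `Δ c s = ∫₀¹ c' (θ s) dθ`, where smoothness of `Δ` is smooth dependence
of the integral on parameters (`contDiff_parametric_integral`). It passes to `C^∞(X, F)` and
`J → F` pointwise, since smoothness of `Δ` in the functional diffeology takes care of all
parameters.

* `tangentEquiv`: `F ≃ T_f(F)`. Every generator `p_*(u)` is the velocity of a curve `c` defined on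
  all of `ℝ`. The surface `q (s, τ) = c 0 + τ • Δ c s` is `c` on the diagonal, constant on
  `τ = 0`, and the line in the direction `Δ c 0` on `s = 0`; by additivity on the tangent space of
  `ℝ²` (`velocity_diag`), `c` and that line have the same velocity. So lines give all tangent
  vectors. A nonzero direction is detected by the differential of a linear functional.
* `hectorDiffeology_eq_dvsDiffeology`: both diffeologies are pulled back from `F × F`. The
  coordinates of `Tf` for a plot `f` are obtained by applying `Δ` to a smooth family of curves, so
  they are smooth; conversely a smooth pair `(a, b)` is a Hector plot, obtained from the plot
  `(s, t) ↦ a t + s • b t`; and the diffeology of `F × F` has smooth fibrewise operations.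
* `trivialization_tangentMap`: a smooth linear map acts as itself on both factors of `F × F`.
  Applied to evaluations and coordinate projections, this computes the two natural maps.
-/

namespace Diffeology

/-! ### Smooth maps between diffeological spaces -/

section Smooth

variable {X Y Z : Type*} [DiffeologicalSpace X] [DiffeologicalSpace Y] [DiffeologicalSpace Z]

@[fun_prop]
theorem DSmooth.prodMk {f : X → Y} {g : X → Z} (hf : DSmooth f) (hg : DSmooth g) :
    DSmooth (fun x => (f x, g x)) := fun n p hp => ⟨hf n p hp, hg n p hp⟩

@[fun_prop]
theorem DSmooth.fst {f : X → Y × Z} (hf : DSmooth f) : DSmooth (fun x => (f x).1) :=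
  fun n p hp => (hf n p hp).1

@[fun_prop]
theorem DSmooth.snd {f : X → Y × Z} (hf : DSmooth f) : DSmooth (fun x => (f x).2) :=
  fun n p hp => (hf n p hp).2

theorem dSmooth_pi_iff {J : Type*} {Y : J → Type*} [∀ j, DiffeologicalSpace (Y j)]
    {f : X → ∀ j, Y j} : DSmooth f ↔ ∀ j, DSmooth (fun x => f x j) :=
  ⟨fun h j _ _ hp => h _ _ hp j, fun h _ _ hp j => h j _ _ hp⟩

theorem DSmooth.subtype_val {P : Y → Prop} {f : X → Subtype P} (hf : DSmooth f) :
    DSmooth (fun x => (f x).1) := hf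

theorem DSmooth.subtype_mk {P : Y → Prop} {f : X → Y} (hf : DSmooth f) (h : ∀ x, P (f x)) :
    DSmooth (fun x => (⟨f x, h x⟩ : Subtype P)) := hf

/-- Cartesian closedness: a map into `C^∞(X, Y)` is smooth iff its adjoint is. -/
theorem dSmooth_curry_iff {f : Z → SmoothMap X Y} :
    DSmooth f ↔ DSmooth (fun z : Z × X => f z.1 z.2) :=
  ⟨fun h _ q hq => h _ (fun t => (q t).1) hq.1 _ (fun t => (t, (q t).2)) ⟨isPlot_id', hq.2⟩,
    fun h _ p hp _ q hq => h _ (fun t => (p (q t).1, (q t).2))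
      ⟨isPlot_reparam hp hq.1.contDiff, hq.2⟩⟩

@[fun_prop]
theorem DSmooth.smoothMap_apply {f : Z → SmoothMap X Y} {g : Z → X} (hf : DSmooth f)
    (hg : DSmooth g) : DSmooth (fun z => f z (g z)) :=
  (dSmooth_curry_iff.1 hf).comp (dSmooth_id.prodMk hg)

@[fun_prop]
theorem SmoothMap.dSmooth (f : SmoothMap X Y) : DSmooth (fun x => f x) := f.smooth

instance {E F : Type*} [NormedAddCommGroup E] [NormedSpace ℝ E] [DiffeologicalSpace E]
    [IsContDiffCompatible E] [NormedAddCommGroup F] [NormedSpace ℝ F] [DiffeologicalSpace F]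
    [IsContDiffCompatible F] : IsContDiffCompatible (E × F) where
  isPlot_iff :=
    ⟨fun h => (IsPlot.contDiff h.1).prodMk (IsPlot.contDiff h.2),
      fun h => ⟨h.fst.isPlot, h.snd.isPlot⟩⟩

end Smooth

/-! ### Hadamard's lemma with parameters -/

section Parametric

variable {E G : Type*} [NormedAddCommGroup E] [NormedSpace ℝ E] [FiniteDimensional ℝ E]
  [NormedAddCommGroup G] [NormedSpace ℝ G]

/-- Differentiation under the integral sign; the derivative of the integrand is bounded on the
compact set `closedBall x 1 ×ˢ [0, 1]`. -/
theorem hasFDerivAt_parametric_integral {g : E × ℝ → G} (hg : ContDiff ℝ ∞ g) (x : E) :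
    HasFDerivAt (fun x => ∫ θ in (0 : ℝ)..1, g (x, θ))
      (∫ θ in (0 : ℝ)..1, (fderiv ℝ g (x, θ)).comp (ContinuousLinearMap.inl ℝ E ℝ)) x := by
  have hd : Continuous (fun z => (fderiv ℝ g z).comp (ContinuousLinearMap.inl ℝ E ℝ)) :=
    (hg.continuous_fderiv (by simp)).clm_comp continuous_const
  obtain ⟨C, hC⟩ := ((isCompact_closedBall x 1).prod (isCompact_uIcc (a := (0 : ℝ)) (b := 1))
    ).exists_bound_of_continuousOn hd.continuousOn
  refine intervalIntegral.hasFDerivAt_integral_of_dominated_of_fderiv_le (bound := fun _ => C)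
    (F' := fun x θ => (fderiv ℝ g (x, θ)).comp (ContinuousLinearMap.inl ℝ E ℝ))
    (Metric.closedBall_mem_nhds x one_pos) ?_ ?_ ?_ ?_ ?_ ?_
  · exact .of_forall fun y =>
      (hg.continuous.comp (by fun_prop : Continuous fun θ : ℝ => (y, θ))).aestronglyMeasurable
  · exact (hg.continuous.comp (by fun_prop : Continuous fun θ : ℝ => (x, θ))).intervalIntegrable _ _
  · exact (hd.comp (by fun_prop : Continuous fun θ : ℝ => (x, θ))).aestronglyMeasurable
  · exact .of_forall fun θ hθ y hy => hC (y, θ) ⟨hy, Set.uIoc_subset_uIcc hθ⟩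
  · simp
  · refine .of_forall fun θ _ y _ => ?_
    exact ((hg.differentiable (by simp)) (y, θ)).hasFDerivAt.comp y (hasFDerivAt_prodMk_left y θ)

theorem contDiff_parametric_integral {g : E × ℝ → G} (hg : ContDiff ℝ ∞ g) :
    ContDiff ℝ ∞ (fun x => ∫ θ in (0 : ℝ)..1, g (x, θ)) := by
  rw [contDiff_infty]
  intro n
  induction n generalizing g with
  | zero =>
    exact contDiff_zero.2 (continuous_iff_continuousAt.2 fun x =>
      (hasFDerivAt_parametric_integral hg x).continuousAt)
  | succ n ih =>
    rw [Nat.cast_add, Nat.cast_one, contDiff_succ_iff_fderiv_apply]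
    refine ⟨fun x => (hasFDerivAt_parametric_integral hg x).differentiableAt, by simp, fun y => ?_⟩
    have hd : Continuous (fun z => (fderiv ℝ g z).comp (ContinuousLinearMap.inl ℝ E ℝ)) :=
      (hg.continuous_fderiv (by simp)).clm_comp continuous_const
    have e : (fun x => fderiv ℝ (fun x => ∫ θ in (0 : ℝ)..1, g (x, θ)) x y) =
        fun x => ∫ θ in (0 : ℝ)..1, fderiv ℝ g (x, θ) (y, 0) := by
      funext x
      rw [(hasFDerivAt_parametric_integral hg x).fderiv]
      exact ContinuousLinearMap.intervalIntegral_apply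
        ((hd.comp (by fun_prop : Continuous fun θ : ℝ => (x, θ))).intervalIntegrable _ _) y
    rw [e]
    exact ih (g := fun z => fderiv ℝ g z (y, 0))
      ((hg.fderiv_right (m := ∞) (by simp)).clm_apply contDiff_const)

/-- Hadamard's lemma in one variable. -/
theorem eq_add_smul_integral_deriv [CompleteSpace G] {c : ℝ → G} (hc : ContDiff ℝ ∞ c) (s : ℝ) :
    c s = c 0 + s • ∫ θ in (0 : ℝ)..1, deriv c (θ * s) := by
  have h : ∀ θ ∈ Set.uIcc (0 : ℝ) 1, HasDerivAt (fun θ => c (θ * s)) (s • deriv c (θ * s)) θ := by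
    intro θ _
    have h1 := ((hc.differentiable (by simp)) (θ * s)).hasDerivAt
    exact h1.scomp θ (hasDerivAt_mul_const s)
  have hi : Continuous (fun θ => s • deriv c (θ * s)) :=
    continuous_const.smul ((hc.continuous_deriv (by simp)).comp (by fun_prop))
  rw [← intervalIntegral.integral_smul,
    intervalIntegral.integral_eq_sub_of_hasDerivAt h (hi.intervalIntegrable _ _)]
  simp

end Parametric

/-! ### Diffeological vector spaces with Hadamard quotients -/

/-- A diffeological vector space: addition and scalar multiplication are smooth. -/
class IsDiffeologicalModule (F : Type*) [DiffeologicalSpace F] [AddCommGroup F] [Module ℝ F] :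
    Prop where
  dSmooth_add : DSmooth (fun z : F × F => z.1 + z.2)
  dSmooth_smul : DSmooth (fun z : ℝ × F => z.1 • z.2)

/-- A diffeological vector space in which calculus along curves works: the smooth linear
functionals separate points, and every smooth curve `c` satisfies `c s = c 0 + s • Δ c s` with
`Δ c` a smooth curve depending smoothly on `c`. In particular `Δ c 0` is the derivative of `c`
at `0`. -/
class IsHadamardSpace (F : Type*) [DiffeologicalSpace F] [AddCommGroup F] [Module ℝ F] : Prop
    extends IsDiffeologicalModule F where
  exists_dual : ∀ f : F, f ≠ 0 → ∃ l : F →ₗ[ℝ] ℝ, DSmooth l ∧ l f ≠ 0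
  exists_quotient : ∃ Δ : SmoothMap ℝ F → SmoothMap ℝ F, DSmooth Δ ∧
    ∀ (c : SmoothMap ℝ F) (s : ℝ), c s = c 0 + s • Δ c s

section Module

variable {X F : Type*} [DiffeologicalSpace X] [DiffeologicalSpace F] [AddCommGroup F] [Module ℝ F]
  [IsDiffeologicalModule F]

@[fun_prop]
theorem DSmooth.add {f g : X → F} (hf : DSmooth f) (hg : DSmooth g) :
    DSmooth (fun x => f x + g x) := IsDiffeologicalModule.dSmooth_add.comp (hf.prodMk hg)

@[fun_prop]
theorem DSmooth.smul {a : X → ℝ} {f : X → F} (ha : DSmooth a) (hf : DSmooth f) :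
    DSmooth (fun x => a x • f x) := IsDiffeologicalModule.dSmooth_smul.comp (ha.prodMk hf)

variable (X F) in
/-- The smooth functions `X → F`, as a subspace of all functions. -/
def smoothFunctions : Submodule ℝ (X → F) where
  carrier := {f | DSmooth f}
  zero_mem' := dSmooth_const
  add_mem' := DSmooth.add
  smul_mem' _ _ := DSmooth.smul dSmooth_const

variable (X F) in
/-- `C^∞(X, F)` is the space of smooth functions `X → F`. -/
def SmoothMap.equivSmoothFunctions : SmoothMap X F ≃ smoothFunctions X F where
  toFun f := ⟨f, f.smooth⟩
  invFun f := ⟨f.1, f.2⟩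
  left_inv _ := rfl
  right_inv _ := rfl

instance : AddCommGroup (SmoothMap X F) := (SmoothMap.equivSmoothFunctions X F).addCommGroup

instance : Module ℝ (SmoothMap X F) := (SmoothMap.equivSmoothFunctions X F).module ℝ

theorem SmoothMap.add_apply (f g : SmoothMap X F) (x : X) : (f + g) x = f x + g x := rfl

theorem SmoothMap.smul_apply (a : ℝ) (f : SmoothMap X F) (x : X) : (a • f) x = a • f x := rfl

instance : IsDiffeologicalModule (SmoothMap X F) where
  dSmooth_add := dSmooth_curry_iff.2 <| by
    simp only [SmoothMap.add_apply]
    fun_prop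
  dSmooth_smul := dSmooth_curry_iff.2 <| by
    simp only [SmoothMap.smul_apply]
    fun_prop

instance {J : Type*} : IsDiffeologicalModule (J → F) where
  dSmooth_add := dSmooth_pi_iff.2 fun j =>
    ((dSmooth_pi_iff.1 dSmooth_id j).comp dSmooth_id.fst).add
      ((dSmooth_pi_iff.1 dSmooth_id j).comp dSmooth_id.snd)
  dSmooth_smul := dSmooth_pi_iff.2 fun j =>
    dSmooth_id.fst.smul ((dSmooth_pi_iff.1 dSmooth_id j).comp dSmooth_id.snd)

end Module

section Instances

instance (n : ℕ) : IsHadamardSpace (Euc n) where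
  dSmooth_add := (contDiff_fst.add contDiff_snd).dSmooth
  dSmooth_smul := (contDiff_fst.smul contDiff_snd).dSmooth
  exists_dual f hf := by
    obtain ⟨i, hi⟩ : ∃ i, f i ≠ 0 := by
      by_contra! h
      exact hf (PiLp.ext h)
    exact ⟨(EuclideanSpace.proj i : Euc n →L[ℝ] ℝ).toLinearMap,
      (EuclideanSpace.proj i : Euc n →L[ℝ] ℝ).contDiff.dSmooth, hi⟩
  exists_quotient := by
    -- The quotient is `∫₀¹ c' (θ * s) dθ`
    have key : ∀ (k : ℕ) (P : Euc k → SmoothMap ℝ (Euc n)), DSmooth P →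
        DSmooth (fun z : Euc k × ℝ => ∫ θ in (0 : ℝ)..1, deriv (P z.1) (θ * z.2)) := by
      intro k P hP
      have hP' : ContDiff ℝ ∞ (fun z : Euc k × ℝ => P z.1 z.2) := (dSmooth_curry_iff.1 hP).contDiff
      have e : ∀ t r, deriv (P t) r = fderiv ℝ (fun z : Euc k × ℝ => P z.1 z.2) (t, r) (0, 1) := by
        intro t r
        have h1 := (hP'.differentiable (by simp) (t, r)).hasFDerivAt
        exact (h1.comp_hasDerivAt r ((hasDerivAt_const r t).prodMk (hasDerivAt_id r))).deriv
      simp only [e]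
      refine (contDiff_parametric_integral (E := Euc k × ℝ) (g := fun w => fderiv ℝ
        (fun z : Euc k × ℝ => P z.1 z.2) (w.1.1, w.2 * w.1.2) (0, 1)) ?_).dSmooth
      exact ((hP'.fderiv_right (m := ∞) (by simp)).comp (by fun_prop)).clm_apply contDiff_const
    refine ⟨fun c => ⟨fun s => ∫ θ in (0 : ℝ)..1, deriv c (θ * s), ?_⟩, ?_, ?_⟩
    · exact (key 0 (fun _ => c) dSmooth_const).comp
        (dSmooth_const (y := (0 : Euc 0)).prodMk dSmooth_id)
    · exact fun k P hP => key k P hP.dSmooth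
    · exact fun c s => eq_add_smul_integral_deriv c.smooth.contDiff s

variable {F : Type*} [DiffeologicalSpace F] [AddCommGroup F] [Module ℝ F] [IsHadamardSpace F]

/-- A curve in `C^∞(X, F)` is a smooth family of curves in `F` indexed by `X`, so the quotient can
be taken pointwise. -/
instance {X : Type*} [DiffeologicalSpace X] : IsHadamardSpace (SmoothMap X F) where
  exists_dual f hf := by
    obtain ⟨x, hx⟩ : ∃ x, f x ≠ 0 := by
      by_contra! h
      exact hf (SmoothMap.ext (funext h))
    obtain ⟨l, hl, hne⟩ := IsHadamardSpace.exists_dual (f x) hx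
    let ev : SmoothMap X F →ₗ[ℝ] F :=
      { toFun := fun g => g x
        map_add' := fun _ _ => rfl
        map_smul' := fun _ _ => rfl }
    exact ⟨l ∘ₗ ev, hl.comp (SmoothMap.dSmooth_eval x), hne⟩
  exists_quotient := by
    obtain ⟨Δ, hΔ, h⟩ := IsHadamardSpace.exists_quotient (F := F)
    let σ : SmoothMap ℝ (SmoothMap X F) × X → SmoothMap ℝ F := fun z =>
      ⟨fun s => z.1 s z.2, by fun_prop⟩
    have hσ : DSmooth σ := dSmooth_curry_iff.2 <|
      (show DSmooth fun z : (SmoothMap ℝ (SmoothMap X F) × X) × ℝ => z.1.1 z.2 z.1.2 by fun_prop)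
    have hΔσ : DSmooth fun z => Δ (σ z) := hΔ.comp hσ
    refine ⟨fun c => ⟨fun s => ⟨fun x => Δ (σ (c, x)) s, by fun_prop⟩,
      dSmooth_curry_iff.2 ?_⟩, dSmooth_curry_iff.2 (dSmooth_curry_iff.2 ?_), fun c s => ?_⟩
    · show DSmooth fun z : ℝ × X => Δ (σ (c, z.2)) z.1
      fun_prop
    · show DSmooth fun z : (SmoothMap ℝ (SmoothMap X F) × ℝ) × X => Δ (σ (z.1.1, z.2)) z.1.2
      fun_prop
    · exact SmoothMap.ext (funext fun x => h (σ (c, x)) s)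

instance {J : Type*} : IsHadamardSpace (J → F) where
  exists_dual f hf := by
    obtain ⟨j, hj⟩ := Function.ne_iff.1 hf
    obtain ⟨l, hl, hne⟩ := IsHadamardSpace.exists_dual (f j) hj
    exact ⟨l ∘ₗ LinearMap.proj j, hl.comp (dSmooth_pi_iff.1 dSmooth_id j), hne⟩
  exists_quotient := by
    obtain ⟨Δ, hΔ, h⟩ := IsHadamardSpace.exists_quotient (F := F)
    let σ : J → SmoothMap ℝ (J → F) → SmoothMap ℝ F := fun j c =>
      ⟨fun s => c s j, dSmooth_pi_iff.1 c.smooth j⟩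
    have hσ : ∀ j, DSmooth (σ j) := fun j => dSmooth_curry_iff.2 <|
      dSmooth_pi_iff.1 (dSmooth_curry_iff.1 dSmooth_id) j
    refine ⟨fun c => ⟨fun s j => Δ (σ j c) s, dSmooth_pi_iff.2 fun j => (Δ (σ j c)).smooth⟩,
      dSmooth_curry_iff.2 (dSmooth_pi_iff.2 fun j => ?_), fun c s => funext fun j => h (σ j c) s⟩
    exact dSmooth_curry_iff.1 (hΔ.comp (hσ j))

end Instances

noncomputable section

/-! ### Velocities of curves -/

section Velocity

variable {X Y : Type*} [DiffeologicalSpace X] [DiffeologicalSpace Y]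

/-- A plot defined on all of `ℝᵏ`, as a centred plot. -/
def CenteredPlot.ofSmooth {k : ℕ} (P : Euc k → X) (hP : DSmooth P) {x : X} (h : P 0 = x) :
    CenteredPlot X x where
  dim := k
  dom := Set.univ
  isOpen_dom := isOpen_univ
  isConnected_dom := isConnected_univ
  zero_mem := trivial
  toFun w := P w
  smooth := fun _ p hp => hP _ (fun t => (p t : Euc k)) hp
  map_zero := h

theorem dSmooth_coord {k : ℕ} (i : Fin k) : DSmooth (fun w : Euc k => w i) :=
  (EuclideanSpace.proj i : Euc k →L[ℝ] ℝ).contDiff.dSmooth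

/-- A smooth curve through `x`, as a centred plot with domain `ℝ¹`. -/
def CenteredPlot.ofCurve (c : SmoothMap ℝ X) {x : X} (h : c 0 = x) : CenteredPlot X x :=
  .ofSmooth (fun w : Euc 1 => c (w 0)) (c.smooth.comp (dSmooth_coord 0)) h

/-- The velocity at time `0` of a smooth curve through `x`. -/
def velocity (c : SmoothMap ℝ X) {x : X} (h : c 0 = x) : InternalTangentSpace X x :=
  (CenteredPlot.ofCurve c h).push (EuclideanSpace.single (0 : Fin 1) 1)

theorem hasFDerivAt_comp_coord {E : Type*} [NormedAddCommGroup E] [NormedSpace ℝ E] {g : ℝ → E}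
    {v : E} (hg : HasDerivAt g v 0) :
    HasFDerivAt (fun w : Euc 1 => g (w 0))
      ((EuclideanSpace.proj (0 : Fin 1) : Euc 1 →L[ℝ] ℝ).smulRight v) 0 := by
  have h1 : HasFDerivAt (fun w : Euc 1 => w 0)
      (EuclideanSpace.proj (0 : Fin 1) : Euc 1 →L[ℝ] ℝ) 0 :=
    (EuclideanSpace.proj (0 : Fin 1) : Euc 1 →L[ℝ] ℝ).hasFDerivAt
  exact HasFDerivAt.comp (g := g) (0 : Euc 1) hg.hasFDerivAt h1

/-- The chain rule for velocities of curves that factor through a plot; the base points need only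
be propositionally equal. -/
theorem mk_velocity_eq_push {x y : X} (hxy : x = y) {c : SmoothMap ℝ X} (h : c 0 = x)
    (p : CenteredPlot X y) {g : ℝ → Euc p.dim} {v : Euc p.dim} (hg : ContDiff ℝ ∞ g) (h0 : g 0 = 0)
    (hv : HasDerivAt g v 0) (hm : ∀ s, g s ∈ p.dom) (hc : ∀ s, c s = p.toFun ⟨g s, hm s⟩) :
    InternalTangentBundle.mk x (velocity c h) = .mk y (p.push v) := by
  have hom : IsCenteredHom (CenteredPlot.ofCurve c h) p (fun w : Euc 1 => g (w 0)) :=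
    { contDiffOn :=
        (hg.comp (EuclideanSpace.proj (0 : Fin 1) : Euc 1 →L[ℝ] ℝ).contDiff).contDiffOn
      mapsTo := fun w _ => hm (w.ofLp (0 : Fin 1))
      map_zero := h0
      comm := fun w => (hc (w.1.ofLp (0 : Fin 1))).symm }
  refine (mk_push_eq hxy _ p hom _).trans ?_
  have e : fderiv ℝ (fun w : Euc 1 => g (w 0)) 0 (EuclideanSpace.single 0 1) = v := by
    rw [(hasFDerivAt_comp_coord hv).fderiv]
    simp
  exact congrArg (fun v => InternalTangentBundle.mk y (p.push v)) e

theorem InternalTangentBundle.mk_injective (x : X) :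
    Function.Injective (InternalTangentBundle.mk x) := sigma_mk_injective

theorem velocity_eq_push {x : X} {c : SmoothMap ℝ X} (h : c 0 = x) (p : CenteredPlot X x)
    {g : ℝ → Euc p.dim} {v : Euc p.dim} (hg : ContDiff ℝ ∞ g) (h0 : g 0 = 0)
    (hv : HasDerivAt g v 0) (hm : ∀ s, g s ∈ p.dom) (hc : ∀ s, c s = p.toFun ⟨g s, hm s⟩) :
    velocity c h = p.push v :=
  InternalTangentBundle.mk_injective x (mk_velocity_eq_push rfl h p hg h0 hv hm hc)

/-- The velocity of a curve `s ↦ P (s • v)` in a globally defined plot `P`. -/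
theorem velocity_eq_push_ofSmooth {k : ℕ} {P : Euc k → X} (hP : DSmooth P) {x : X} (h : P 0 = x)
    {c : SmoothMap ℝ X} (hc : c 0 = x) (v : Euc k) (hcP : ∀ s, c s = P (s • v)) :
    velocity c hc = (CenteredPlot.ofSmooth P hP h).push v :=
  have hv : HasDerivAt (fun s : ℝ => s • v) v 0 := by
    simpa using (hasDerivAt_id (0 : ℝ)).smul_const v
  velocity_eq_push hc (.ofSmooth P hP h) (contDiff_id.smul contDiff_const) (zero_smul ℝ v)
    hv (fun _ => trivial) hcP

theorem velocity_const {x : X} {c : SmoothMap ℝ X} (hc : ∀ s, c s = x) :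
    velocity c (hc 0) = 0 :=
  (velocity_eq_push_ofSmooth (k := 0) (P := fun _ => x) dSmooth_const rfl (hc 0) 0 hc).trans
    (map_zero _)

theorem velocity_comp_mul {x : X} {c d : SmoothMap ℝ X} (hc : c 0 = x) (hd : d 0 = x) (a : ℝ)
    (h : ∀ s, d s = c (s * a)) : velocity d hd = a • velocity c hc := by
  refine (velocity_eq_push_ofSmooth (P := fun w : Euc 1 => c (w 0))
    (c.smooth.comp (dSmooth_coord 0)) hc hd (a • EuclideanSpace.single 0 1)
    (fun s => (h s).trans (by simp))).trans ?_
  exact map_smul _ a _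

/-- The velocity of the diagonal of a surface is the sum of the velocities along the two axes. -/
theorem velocity_diag {x : X} {q : ℝ × ℝ → X} (hq : DSmooth q) {c d e : SmoothMap ℝ X}
    (hc : c 0 = x) (hd : d 0 = x) (he : e 0 = x) (hcq : ∀ s, c s = q (s, s))
    (hdq : ∀ s, d s = q (s, 0)) (heq : ∀ s, e s = q (0, s)) :
    velocity c hc = velocity d hd + velocity e he := by
  have hP : DSmooth (fun w : Euc 2 => q (w 0, w 1)) :=
    hq.comp ((dSmooth_coord 0).prodMk (dSmooth_coord 1))
  have h0 := (hcq 0).symm.trans hc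
  rw [velocity_eq_push_ofSmooth hP h0 hc (EuclideanSpace.single 0 1 + EuclideanSpace.single 1 1)
      (by simpa using hcq),
    velocity_eq_push_ofSmooth hP h0 hd (EuclideanSpace.single 0 1) (by simpa using hdq),
    velocity_eq_push_ofSmooth hP h0 he (EuclideanSpace.single 1 1) (by simpa using heq)]
  exact map_add _ _ _

theorem tangentMap_velocity {f : X → Y} (hf : DSmooth f) {x : X} {c : SmoothMap ℝ X} (h : c 0 = x) :
    tangentMap f hf x (velocity c h) = velocity ⟨f ∘ c, hf.comp c.smooth⟩ (congrArg f h) :=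
  InternalTangentSpace.desc_push _ _ _ _

theorem hasDerivAt_mul_sin_smul {E : Type*} [NormedAddCommGroup E] [NormedSpace ℝ E] {ε : ℝ}
    (hε : ε ≠ 0) (u : E) : HasDerivAt (fun s : ℝ => (ε * Real.sin (s / ε)) • u) u 0 := by
  have h1 : HasDerivAt (fun s : ℝ => ε * Real.sin (s / ε)) 1 0 := by
    have h := (((hasDerivAt_id (0 : ℝ)).div_const ε).sin).const_mul ε
    simpa [hε] using h
  simpa using h1.smul_const u

theorem contDiff_mul_sin (ε : ℝ) : ContDiff ℝ ∞ (fun s : ℝ => ε * Real.sin (s / ε)) :=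
  contDiff_const.mul (Real.contDiff_sin.comp (contDiff_id.div_const ε))

theorem abs_mul_sin_le {ε : ℝ} (hε : 0 < ε) (s : ℝ) : |ε * Real.sin (s / ε)| ≤ ε := by
  rw [abs_mul, abs_of_pos hε]
  exact mul_le_of_le_one_right hε.le (Real.abs_sin_le_one _)

/-- Every generating tangent vector `p_*(u)` is the velocity of a curve defined on all of `ℝ`:
replace `s ↦ p (s • u)`, defined near `0` only, by `s ↦ p ((ε * sin (s / ε)) • u)`. -/
theorem exists_velocity_eq_push {x : X} (p : CenteredPlot X x) (u : Euc p.dim) :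
    ∃ (c : SmoothMap ℝ X) (h : c 0 = x), p.push u = velocity c h := by
  have hU : (fun r : ℝ => r • u) ⁻¹' p.dom ∈ nhds 0 :=
    (p.isOpen_dom.preimage (by fun_prop)).mem_nhds (by simpa using p.zero_mem)
  obtain ⟨ε, hε, hb⟩ := Metric.nhds_basis_closedBall.mem_iff.1 hU
  have hm : ∀ s : ℝ, (ε * Real.sin (s / ε)) • u ∈ p.dom := fun s =>
    hb (by simpa using abs_mul_sin_le hε s)
  have hg : ContDiff ℝ ∞ (fun s : ℝ => (ε * Real.sin (s / ε)) • u) :=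
    (contDiff_mul_sin ε).smul contDiff_const
  let c : SmoothMap ℝ X := ⟨fun s => p.toFun ⟨(ε * Real.sin (s / ε)) • u, hm s⟩,
    p.smooth.comp (hg.dSmooth.subtype_mk hm)⟩
  have hc : c 0 = x := by
    refine Eq.trans ?_ p.map_zero
    simp [c]
  exact ⟨c, hc, (velocity_eq_push hc p hg (by simp) (hasDerivAt_mul_sin_smul hε.ne' u) hm
    fun _ => rfl).symm⟩

end Velocity

/-! ### The differential of a smooth function -/

section Differential

variable {X : Type*} [DiffeologicalSpace X]

/-- A smooth function on an open subset of `ℝᵏ`, extended by zero, is smooth at the points of that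
subset. -/
theorem DSmooth.contDiffAt_extend {k : ℕ} {U : Set (Euc k)} (hU : IsOpen U) {l : U → ℝ}
    (hl : DSmooth l) (x : U) : ContDiffAt ℝ ∞ (Function.extend Subtype.val l 0) (x : Euc k) := by
  obtain ⟨ε, hε, hb⟩ := Metric.isOpen_iff.1 hU x x.2
  -- plots are defined on all of `ℝᵏ`, so a ball around `x` is parametrized by `ℝᵏ`
  let φ := OpenPartialHomeomorph.univBall (x : Euc k) ε
  have hm : ∀ t, φ t ∈ U := fun t => hb <| by
    have h := φ.map_source (x := t) (by simp [φ])
    rwa [OpenPartialHomeomorph.univBall_target _ hε] at h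
  have h1 : ContDiff ℝ ∞ (fun t => l ⟨φ t, hm t⟩) :=
    (hl k (fun t => ⟨φ t, hm t⟩)
      (ContDiff.isPlot (p := fun t => φ t) OpenPartialHomeomorph.contDiff_univBall)).contDiff
  have h2 : ContDiffOn ℝ ∞ (fun z => l ⟨φ (φ.symm z), hm _⟩) (Metric.ball (x : Euc k) ε) :=
    h1.comp_contDiffOn OpenPartialHomeomorph.contDiffOn_univBall_symm
  refine (h2.congr fun z hz => ?_).contDiffAt (Metric.ball_mem_nhds _ hε)
  have e : φ (φ.symm z) = z :=
    φ.right_inv (by rwa [OpenPartialHomeomorph.univBall_target _ hε])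
  simp only [e]
  exact Subtype.val_injective.extend_apply l 0 ⟨z, hb hz⟩

/-- The differential `T_x(X) → ℝ` of a smooth function `l : X → ℝ`; it sends `p_*(u)` to the
derivative of `l ∘ p` at `0` in the direction `u`. -/
def differential (l : X → ℝ) (hl : DSmooth l) (x : X) : InternalTangentSpace X x →ₗ[ℝ] ℝ :=
  InternalTangentSpace.desc
    (fun p => (fderiv ℝ (Function.extend Subtype.val (l ∘ p.toFun) 0) (0 : Euc p.dim)).toLinearMap)
    fun p q f hf u => by
      have hq : DifferentiableAt ℝ (Function.extend Subtype.val (l ∘ q.toFun) 0) (f 0) := by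
        rw [hf.map_zero]
        exact ((hl.comp q.smooth).contDiffAt_extend q.isOpen_dom ⟨0, q.zero_mem⟩).differentiableAt
          (by simp)
      have hf' : DifferentiableAt ℝ f 0 :=
        (hf.contDiffOn.contDiffAt (p.isOpen_dom.mem_nhds p.zero_mem)).differentiableAt (by simp)
      have e : Function.extend Subtype.val (l ∘ p.toFun) 0 =ᶠ[nhds 0]
          Function.extend Subtype.val (l ∘ q.toFun) 0 ∘ f := by
        filter_upwards [p.isOpen_dom.mem_nhds p.zero_mem] with w hw
        rw [Function.comp_apply, Subtype.val_injective.extend_apply (l ∘ p.toFun) 0 ⟨w, hw⟩,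
          Subtype.val_injective.extend_apply (l ∘ q.toFun) 0 ⟨f w, hf.mapsTo hw⟩]
        exact congrArg l (hf.comm ⟨w, hw⟩).symm
      have h := fderiv_comp (0 : Euc p.dim) hq hf'
      rw [hf.map_zero] at h
      show fderiv ℝ _ _ u = fderiv ℝ _ _ _
      rw [e.fderiv_eq, h]
      rfl

theorem differential_velocity {l : X → ℝ} (hl : DSmooth l) {x : X} {c : SmoothMap ℝ X}
    (h : c 0 = x) : differential l hl x (velocity c h) = deriv (fun s => l (c s)) 0 := by
  refine (InternalTangentSpace.desc_push _ _ _ _).trans ?_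
  have hlc : ContDiff ℝ ∞ (fun s => l (c s)) := (hl.comp c.smooth).contDiff
  have e : Function.extend Subtype.val (l ∘ (CenteredPlot.ofCurve c h).toFun) 0 =
      fun w : Euc 1 => l (c (w 0)) :=
    funext fun w => Subtype.val_injective.extend_apply (l ∘ (CenteredPlot.ofCurve c h).toFun) 0
      ⟨w, trivial⟩
  have h1 := (hasFDerivAt_comp_coord ((hlc.differentiable (by simp)) 0).hasDerivAt).fderiv
  refine (congrArg (fun g : Euc 1 → ℝ => fderiv ℝ g 0 (EuclideanSpace.single 0 1)) e).trans ?_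
  rw [h1]
  simp

end Differential

/-! ### Tangent vectors of a Hadamard space -/

section Line

variable {F : Type*} [DiffeologicalSpace F] [AddCommGroup F] [Module ℝ F] [IsHadamardSpace F]

/-- The affine line `s ↦ f + s • g`. -/
def line (f g : F) : SmoothMap ℝ F := ⟨fun s => f + s • g, by fun_prop⟩

theorem line_zero (f g : F) : line f g 0 = f := by simp [line]

/-- The map `F → T_f(F)` sending `g` to the velocity of the line `s ↦ f + s • g`. -/
def lineVelocity (f : F) : F →ₗ[ℝ] InternalTangentSpace F f where
  toFun g := velocity (line f g) (line_zero f g)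
  map_add' g h := velocity_diag (q := fun z : ℝ × ℝ => f + z.1 • g + z.2 • h) (by fun_prop) _ _ _
    (fun s => by simp [line, add_assoc]) (fun s => by simp [line]) (fun s => by simp [line])
  map_smul' a g := velocity_comp_mul _ _ a fun s => by simp [line, mul_smul]

/-- Only the first-order part of a curve matters: deform `c` to its tangent line through the
surface `(s, τ) ↦ c 0 + τ • Δ c s`, which is `c` on the diagonal and constant for `τ = 0`. -/
theorem velocity_eq_lineVelocity {c d : SmoothMap ℝ F} (hd : ∀ s, c s = c 0 + s • d s) {f : F}
    (h : c 0 = f) : velocity c h = lineVelocity f (d 0) := by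
  subst h
  have hconst := velocity_const (c := ⟨fun _ => c 0, dSmooth_const⟩) (fun _ => rfl)
  refine (velocity_diag (q := fun z : ℝ × ℝ => c 0 + z.2 • d z.1) (by fun_prop) _ rfl
    (line_zero _ _) hd (d := ⟨fun _ => c 0, dSmooth_const⟩) (fun s => by simp)
    (fun s => rfl : ∀ s, line (c 0) (d 0) s = c 0 + s • d 0)).trans ?_
  rw [hconst, zero_add]
  rfl

/-- Injectivity holds because smooth linear functionals separate points and have differentials on
`T_f(F)`; surjectivity because every tangent vector is a sum of velocities of curves. -/
theorem lineVelocity_bijective (f : F) : Function.Bijective (lineVelocity f) := by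
  constructor
  · rw [injective_iff_map_eq_zero]
    intro g hg
    by_contra hne
    obtain ⟨l, hl, hlg⟩ := IsHadamardSpace.exists_dual g hne
    have h := differential_velocity hl (line_zero f g)
    have h' : HasDerivAt (fun s : ℝ => l f + s * l g) (l g) 0 := by
      simpa using ((hasDerivAt_id (0 : ℝ)).mul_const (l g)).const_add (l f)
    have e : (fun s => l (line f g s)) = fun s : ℝ => l f + s * l g := by
      funext s; simp [line]
    rw [e, h'.deriv] at h
    refine hlg (h.symm.trans ?_)
    rw [show velocity (line f g) (line_zero f g) = 0 from hg, map_zero]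
  · intro v
    induction v using InternalTangentSpace.induction with
    | zero => exact ⟨0, map_zero _⟩
    | push p u =>
      obtain ⟨Δ, -, h⟩ := IsHadamardSpace.exists_quotient (F := F)
      obtain ⟨c, hc, e⟩ := exists_velocity_eq_push p u
      exact ⟨Δ c 0, by rw [e, velocity_eq_lineVelocity (h c)]⟩
    | add v w hv hw =>
      obtain ⟨g, rfl⟩ := hv
      obtain ⟨k, rfl⟩ := hw
      exact ⟨g + k, map_add _ _ _⟩

/-- The tangent space of a Hadamard space at any point is the space itself. -/
def tangentEquiv (f : F) : F ≃ₗ[ℝ] InternalTangentSpace F f :=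
  .ofBijective (lineVelocity f) (lineVelocity_bijective f)

variable (F) in
/-- The global trivialization `TF ≃ F × F` of the tangent bundle. -/
def trivialization : InternalTangentBundle F ≃ F × F where
  toFun z := (z.1, (tangentEquiv z.1).symm z.2)
  invFun a := .mk a.1 (tangentEquiv a.1 a.2)
  left_inv := fun ⟨_, _⟩ => congrArg (InternalTangentBundle.mk _) (LinearEquiv.apply_symm_apply _ _)
  right_inv := fun ⟨_, _⟩ => congrArg (Prod.mk _) (LinearEquiv.symm_apply_apply _ _)

end Line

/-! ### The diffeology of the tangent bundle of a Hadamard space -/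

section Bundle

variable (F : Type*) [DiffeologicalSpace F] [AddCommGroup F] [Module ℝ F] [IsHadamardSpace F]

/-- The maps `Tf` are smooth in the trivialization: locally, a family of tangent vectors of a
plot is the family of velocities of a smooth family of curves, so it is differentiated by `Δ`. -/
theorem dSmooth_trivialization_plotTangentMap {m : ℕ} {U : Set (Euc m)} (hU : IsOpen U)
    (hc : IsConnected U) (f : U → F) (hf : DSmooth f) :
    DSmooth (fun z => trivialization F (plotTangentMap hU hc f hf z)) := by
  intro k g hg
  obtain ⟨Δ, hΔ, hq⟩ := IsHadamardSpace.exists_quotient (F := F)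
  have hg1 : ContDiff ℝ ∞ (fun t => ((g t).1 : Euc m)) := IsPlot.contDiff hg.1
  have hg2 : ContDiff ℝ ∞ (fun t => (g t).2) := IsPlot.contDiff hg.2
  refine ⟨hf k _ hg.1, ?_⟩
  refine DiffeologicalSpace.locality fun t₀ => ?_
  have hW : IsOpen {z : ℝ × Euc k | ((g z.2).1 : Euc m) + z.1 • (g z.2).2 ∈ U} :=
    hU.preimage (((hg1.continuous.comp continuous_snd).add
      (continuous_fst.smul (hg2.continuous.comp continuous_snd))))
  have h0 : ((0 : ℝ), t₀) ∈ {z : ℝ × Euc k | ((g z.2).1 : Euc m) + z.1 • (g z.2).2 ∈ U} := by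
    simp
  -- uniformly for `t` near `t₀`, the points `(g t).1 + r • (g t).2` with `|r| ≤ ε` stay in `U`
  obtain ⟨A, hA, V, hV, hAV⟩ := mem_nhds_prod_iff.1 (hW.mem_nhds h0)
  obtain ⟨V', hVV', hV'o, hV't⟩ := mem_nhds_iff.1 hV
  obtain ⟨ε, hε, hb⟩ := Metric.nhds_basis_closedBall.mem_iff.1 hA
  refine ⟨V', hV'o, hV't, fun {j h} hh hs => ?_⟩
  -- `c t` has velocity the tangent vector at `h t`; the sine keeps it inside `U` for all times
  let γ : Euc j × ℝ → Euc m := fun z =>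
    (ε * Real.sin (z.2 / ε)) • (g (h z.1)).2 + ((g (h z.1)).1 : Euc m)
  have hγ : ContDiff ℝ ∞ γ :=
    (((contDiff_mul_sin ε).comp contDiff_snd).smul (hg2.comp (hs.comp contDiff_fst))).add
      (hg1.comp (hs.comp contDiff_fst))
  have hm : ∀ z, γ z ∈ U := fun z => by
    have h1 := hAV (Set.mk_mem_prod (hb (by simpa using abs_mul_sin_le hε z.2 :
      ε * Real.sin (z.2 / ε) ∈ Metric.closedBall (0 : ℝ) ε)) (hVV' (hh z.1)))
    rwa [Set.mem_ofPred_eq, add_comm] at h1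
  have hF : DSmooth (fun z : Euc j × ℝ => f ⟨γ z, hm z⟩) :=
    hf.comp (hγ.dSmooth.subtype_mk hm)
  let c : Euc j → SmoothMap ℝ F := fun t =>
    ⟨fun s => f ⟨γ (t, s), hm (t, s)⟩, hF.comp (dSmooth_const.prodMk dSmooth_id)⟩
  have hcs : DSmooth c := dSmooth_curry_iff.2 hF
  have hc0 : ∀ t, c t 0 = f (g (h t)).1 := fun t => by simp [c, γ]
  have e : ∀ t, (tangentEquiv (f (g (h t)).1)).symm
      ((translatedPlot hU hc f hf (g (h t)).1).push (g (h t)).2) = Δ (c t) 0 := fun t => by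
    rw [LinearEquiv.symm_apply_eq]
    have h0 : (ε * Real.sin (0 / ε)) • (g (h t)).2 = 0 := by simp
    have h1 := velocity_eq_push (hc0 t) (translatedPlot hU hc f hf (g (h t)).1)
      (g := fun s => (ε * Real.sin (s / ε)) • (g (h t)).2)
      ((contDiff_mul_sin ε).smul contDiff_const) h0
      (hasDerivAt_mul_sin_smul hε.ne' _) (fun s => hm (t, s)) (fun s => rfl)
    exact h1.symm.trans (velocity_eq_lineVelocity (hq (c t)) (hc0 t))
  have hfin : DSmooth (fun t => Δ (c t) 0) := (hΔ.comp hcs).smoothMap_apply dSmooth_const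
  exact (congrArg IsPlot (funext e)).mpr hfin.isPlot

theorem hector_le_trivialization :
    hectorDiffeology F ≤ inducedDiffeology (trivialization F) := by
  rw [DiffeologicalSpace.generateFrom_le_iff]
  rintro k p ⟨m, U, hU, hc, f, hf, g, hg, hp⟩
  rw [show p = plotTangentMap hU hc f hf ∘ g from hp]
  exact dSmooth_trivialization_plotTangentMap F hU hc f hf k g hg

/-- A smooth family of pairs `(a t, b t)` is the family of velocities at `s = 0` of the plot
`(s, t) ↦ a t + s • b t`. -/
theorem trivialization_le_hector :
    inducedDiffeology (trivialization F) ≤ hectorDiffeology F := by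
  rw [DiffeologicalSpace.le_iff']
  intro k p hp
  let a : Euc k → F := fun t => (trivialization F (p t)).1
  let b : Euc k → F := fun t => (trivialization F (p t)).2
  have ha : DSmooth a := IsPlot.dSmooth hp.1
  have hb : DSmooth b := IsPlot.dSmooth hp.2
  let e : (ℝ × Euc k) ≃L[ℝ] Euc (1 + k) := ContinuousLinearEquiv.ofFinrankEq (by simp)
  let Φ : ↥(Set.univ : Set (Euc (1 + k))) → F := fun w =>
    a (e.symm w).2 + (e.symm w).1 • b (e.symm w).2
  have hΦ : DSmooth Φ := by
    have h1 : DSmooth (fun w : (Set.univ : Set (Euc (1 + k))) => e.symm (w : Euc (1 + k))) :=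
      e.symm.contDiff.dSmooth.comp (DSmooth.subtype_val dSmooth_id)
    exact (ha.comp h1.snd).add (h1.fst.smul (hb.comp h1.snd))
  refine DiffeologicalSpace.isPlot_generatedFrom_of_mem ⟨_, Set.univ, isOpen_univ, isConnected_univ,
    Φ, hΦ, fun t => (⟨e (0, t), trivial⟩, e (1, 0)), ⟨?_, isPlot_const⟩, ?_⟩
  · exact ContDiff.isPlot (p := fun t : Euc k => e ((0 : ℝ), t))
      (e.contDiff.comp (contDiff_const.prodMk contDiff_id))
  funext (t : Euc k)
  have hpt : p t = .mk (a t) (velocity (line (a t) (b t)) (line_zero _ _)) :=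
    ((trivialization F).symm_apply_apply (p t)).symm
  refine hpt.trans ?_
  have hg : ContDiff ℝ ∞ (fun s : ℝ => e (s, (0 : Euc k))) :=
    e.contDiff.comp (contDiff_id.prodMk contDiff_const)
  have hd : HasDerivAt (fun s : ℝ => e (s, (0 : Euc k))) (e (1, 0)) 0 :=
    (e : (ℝ × Euc k) →L[ℝ] Euc (1 + k)).hasFDerivAt.comp_hasDerivAt (0 : ℝ)
      ((hasDerivAt_id (0 : ℝ)).prodMk (hasDerivAt_const (0 : ℝ) (0 : Euc k)))
  refine mk_velocity_eq_push (by simp [Φ]) _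
    (translatedPlot isOpen_univ isConnected_univ Φ hΦ ⟨e (0, t), trivial⟩) hg (map_zero e) hd
    (fun _ => trivial) fun s => ?_
  simp [translatedPlot, Φ, line]

/-- The trivialization is linear on the fibres and `F` has smooth operations. -/
theorem isDVSOver_trivialization :
    @IsDVSOver (InternalTangentBundle F) F (inducedDiffeology (trivialization F)) _
      InternalTangentBundle.proj _ := by
  let _ : DiffeologicalSpace (InternalTangentBundle F) := inducedDiffeology (trivialization F)
  have ht : DSmooth (trivialization F) := fun _ _ hp => hp
  refine @IsDVSOver.mk _ _ (_) _ _ _ ht.fst ?_ ?_ ?_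
  · intro n p hp
    have h1 : DSmooth (fun t => trivialization F (p t).1.1) := ht.comp (IsPlot.dSmooth hp.1)
    have h2 : DSmooth (fun t => trivialization F (p t).1.2) := ht.comp (IsPlot.dSmooth hp.2)
    have e : ∀ z : {z : InternalTangentBundle F × InternalTangentBundle F // z.1.proj = z.2.proj},
        trivialization F ((⟨z.1.1, z.2⟩ : Fibre InternalTangentBundle.proj z.1.2.proj) +
          (⟨z.1.2, rfl⟩ : Fibre InternalTangentBundle.proj z.1.2.proj)).val =
        ((trivialization F z.1.1).1, (trivialization F z.1.1).2 + (trivialization F z.1.2).2) := by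
      rintro ⟨⟨⟨x, v⟩, ⟨y, w⟩⟩, h⟩
      obtain rfl : x = y := h
      exact congrArg (Prod.mk x) (map_add (tangentEquiv x).symm v w)
    exact (congrArg IsPlot (funext fun t => e (p t))).mpr (h1.fst.prodMk (h1.snd.add h2.snd)).isPlot
  · intro n p hp
    have h1 : DSmooth (fun t => (p t).1) := IsPlot.dSmooth hp.1
    have h2 : DSmooth (fun t => trivialization F (p t).2) := ht.comp (IsPlot.dSmooth hp.2)
    have e : ∀ z : ℝ × InternalTangentBundle F, trivialization F
        (z.1 • (⟨z.2, rfl⟩ : Fibre InternalTangentBundle.proj z.2.proj)).val =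
        ((trivialization F z.2).1, z.1 • (trivialization F z.2).2) := by
      rintro ⟨r, ⟨x, v⟩⟩
      exact congrArg (Prod.mk x) (map_smul (tangentEquiv x).symm r v)
    exact (congrArg IsPlot (funext fun t => e (p t))).mpr (h2.fst.prodMk (h1.smul h2.snd)).isPlot
  · intro n p hp
    have e : ∀ b : F, trivialization F (0 : Fibre InternalTangentBundle.proj b).val = (b, 0) :=
      fun b => congrArg (Prod.mk b) (map_zero (tangentEquiv b).symm)
    exact (congrArg IsPlot (funext fun t => e (p t))).mpr
      ((IsPlot.dSmooth hp).prodMk dSmooth_const).isPlot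

theorem hectorDiffeology_eq_trivialization :
    hectorDiffeology F = inducedDiffeology (trivialization F) :=
  le_antisymm (hector_le_trivialization F) (trivialization_le_hector F)

theorem dvsDiffeology_eq_trivialization :
    dvsDiffeology F = inducedDiffeology (trivialization F) :=
  le_antisymm (sInf_le ⟨hector_le_trivialization F, isDVSOver_trivialization F⟩)
    ((trivialization_le_hector F).trans (hector_le_dvs F))

theorem hectorDiffeology_eq_dvsDiffeology : hectorDiffeology F = dvsDiffeology F :=
  (hectorDiffeology_eq_trivialization F).trans (dvsDiffeology_eq_trivialization F).symm

variable {F}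

/-- The trivialization `TF ≃ F × F` is a diffeomorphism. -/
theorem dSmooth_iff_trivialization_comp {X : Type*} [DiffeologicalSpace X]
    {φ : X → InternalTangentBundle F} : DSmooth φ ↔ DSmooth (fun x => trivialization F (φ x)) := by
  unfold instDiffeologicalSpaceInternalTangentBundle
  rw [dvsDiffeology_eq_trivialization]
  rfl

end Bundle

end

/-! ### Function spaces and powers of diffeological vector spaces over a base -/

section Constructions

variable {V B : Type*} {π : V → B} [FibrewiseModule π]

theorem Fibre.val_add {b : B} (v w : Fibre π b) : (v + w).val =
    ((⟨v.1, v.2.trans w.2.symm⟩ : Fibre π (π w.1)) + (⟨w.1, rfl⟩ : Fibre π (π w.1))).val := by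
  obtain ⟨w, rfl⟩ := w
  rfl

theorem Fibre.val_smul {b : B} (r : ℝ) (v : Fibre π b) :
    (r • v).val = (r • (⟨v.1, rfl⟩ : Fibre π (π v.1))).val := by
  obtain ⟨v, rfl⟩ := v
  rfl

variable [DiffeologicalSpace V] [DiffeologicalSpace B] [IsDVSOver π]

theorem DSmooth.fibre_add {X : Type*} [DiffeologicalSpace X] {b : X → B} {v w : ∀ x, Fibre π (b x)}
    (hv : DSmooth fun x => (v x).val) (hw : DSmooth fun x => (w x).val) :
    DSmooth fun x => (v x + w x).val := by
  simp only [Fibre.val_add (v _)]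
  exact (IsDVSOver.dSmooth_add (π := π)).comp
    ((hv.prodMk hw).subtype_mk fun x => (v x).2.trans (w x).2.symm)

theorem DSmooth.fibre_smul {X : Type*} [DiffeologicalSpace X] {b : X → B} {r : X → ℝ}
    {v : ∀ x, Fibre π (b x)} (hr : DSmooth r) (hv : DSmooth fun x => (v x).val) :
    DSmooth fun x => (r x • v x).val := by
  simp only [Fibre.val_smul _ (v _)]
  exact (IsDVSOver.dSmooth_smul (π := π)).comp (hr.prodMk hv)

variable (π)

instance (X : Type*) [DiffeologicalSpace X] : IsDVSOver (postcomp π X) where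
  dSmooth_proj := dSmooth_curry_iff.2 <|
    (IsDVSOver.dSmooth_proj (π := π)).comp (dSmooth_curry_iff.1 dSmooth_id)
  dSmooth_add := dSmooth_curry_iff.2 <| by
    have h : DSmooth fun z : {z : SmoothMap X V × SmoothMap X V //
        postcomp π X z.1 = postcomp π X z.2} => z.1 := DSmooth.subtype_val dSmooth_id
    refine DSmooth.fibre_add (π := π) (b := fun z : {z : SmoothMap X V × SmoothMap X V //
        postcomp π X z.1 = postcomp π X z.2} × X => π (z.1.1.2 z.2))
      (v := fun z => ⟨z.1.1.1 z.2, congrFun (congrArg SmoothMap.toFun z.1.2) z.2⟩)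
      (w := fun z => ⟨z.1.1.2 z.2, rfl⟩) ?_ ?_
    · exact ((h.comp dSmooth_id.fst).fst).smoothMap_apply dSmooth_id.snd
    · exact ((h.comp dSmooth_id.fst).snd).smoothMap_apply dSmooth_id.snd
  dSmooth_smul := dSmooth_curry_iff.2 <|
    DSmooth.fibre_smul (π := π) (b := fun z : (ℝ × SmoothMap X V) × X => π (z.1.2 z.2))
      (r := fun z => z.1.1) (v := fun z => ⟨z.1.2 z.2, rfl⟩) (by fun_prop) (by
        show DSmooth fun z : (ℝ × SmoothMap X V) × X => z.1.2 z.2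
        fun_prop)
  dSmooth_zero := dSmooth_curry_iff.2 <|
    (IsDVSOver.dSmooth_zero (π := π)).comp (dSmooth_curry_iff.1 dSmooth_id)

instance (J : Type*) : IsDVSOver (powMap π J) where
  dSmooth_proj := dSmooth_pi_iff.2 fun j =>
    (IsDVSOver.dSmooth_proj (π := π)).comp (dSmooth_pi_iff.1 dSmooth_id j)
  dSmooth_add := dSmooth_pi_iff.2 fun j => by
    have h : DSmooth fun z : {z : (J → V) × (J → V) // powMap π J z.1 = powMap π J z.2} => z.1 :=
      DSmooth.subtype_val dSmooth_id
    exact DSmooth.fibre_add (π := π) (b := fun z : {z : (J → V) × (J → V) //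
        powMap π J z.1 = powMap π J z.2} => π (z.1.2 j))
      (v := fun z => ⟨z.1.1 j, congrFun z.2 j⟩) (w := fun z => ⟨z.1.2 j, rfl⟩)
      (dSmooth_pi_iff.1 h.fst j) (dSmooth_pi_iff.1 h.snd j)
  dSmooth_smul := dSmooth_pi_iff.2 fun j =>
    DSmooth.fibre_smul (π := π) (b := fun z : ℝ × (J → V) => π (z.2 j)) (r := fun z => z.1)
      (v := fun z => ⟨z.2 j, rfl⟩) dSmooth_id.fst (dSmooth_pi_iff.1 dSmooth_id.snd j)
  dSmooth_zero := dSmooth_pi_iff.2 fun j =>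
    (IsDVSOver.dSmooth_zero (π := π)).comp (dSmooth_pi_iff.1 dSmooth_id j)

end Constructions

/-! ### The natural maps in the trivializations -/

section Natural

variable {F G : Type*} [DiffeologicalSpace F] [AddCommGroup F] [Module ℝ F] [IsHadamardSpace F]
  [DiffeologicalSpace G] [AddCommGroup G] [Module ℝ G] [IsHadamardSpace G]

theorem dSmooth_trivialization : DSmooth (trivialization F) :=
  dSmooth_iff_trivialization_comp.1 dSmooth_id

theorem DSmooth.trivialization_symm {X : Type*} [DiffeologicalSpace X] {φ : X → F × F}
    (hφ : DSmooth φ) : DSmooth (fun x => (trivialization F).symm (φ x)) :=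
  dSmooth_iff_trivialization_comp.2 (by simpa using hφ)

/-- A smooth linear map is its own derivative. -/
theorem trivialization_tangentMap {l : F → G} (hl : DSmooth l)
    (hlin : IsLinearMap ℝ l) (z : InternalTangentBundle F) :
    trivialization G (.mk (l z.1) (tangentMap l hl z.1 z.2)) =
      (l (trivialization F z).1, l (trivialization F z).2) := by
  obtain ⟨⟨f, g⟩, rfl⟩ := (trivialization F).symm.surjective z
  rw [Equiv.apply_symm_apply]
  refine congrArg (Prod.mk (l f)) ((LinearEquiv.symm_apply_eq _).2 ?_)
  refine (tangentMap_velocity hl (line_zero f g)).trans ?_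
  have e : (⟨l ∘ line f g, hl.comp (line f g).smooth⟩ : SmoothMap ℝ G) = line (l f) (l g) :=
    SmoothMap.ext (funext fun s => by simp [line, hlin.map_add, hlin.map_smul])
  have aux : ∀ (c : SmoothMap ℝ G) (hc : c 0 = l f), c = line (l f) (l g) →
      velocity c hc = tangentEquiv (l f) (l g) := by
    rintro _ _ rfl
    rfl
  exact aux _ _ e

variable (F)

theorem trivialization_gamma {X : Type*} [DiffeologicalSpace X]
    (z : InternalTangentBundle (SmoothMap X F)) (x : X) :
    trivialization F (gamma X F z x) =
      ((trivialization (SmoothMap X F) z).1 x, (trivialization (SmoothMap X F) z).2 x) :=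
  trivialization_tangentMap (SmoothMap.dSmooth_eval x) ⟨fun _ _ => rfl, fun _ _ => rfl⟩ z

theorem trivialization_powTangentMap {J : Type*} (z : InternalTangentBundle (J → F)) (j : J) :
    trivialization F (powTangentMap J F z j) =
      ((trivialization (J → F) z).1 j, (trivialization (J → F) z).2 j) :=
  trivialization_tangentMap (l := fun y : J → F => y j) _ ⟨fun _ _ => rfl, fun _ _ => rfl⟩ z

/-- In the trivializations, `γ` is the bijection `C^∞(X, F) × C^∞(X, F) ≃ C^∞(X, F × F)`. -/
theorem isDVSIso_gamma (X : Type*) [DiffeologicalSpace X] :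
    IsDVSIso (InternalTangentBundle.proj (X := SmoothMap X F))
      (postcomp (InternalTangentBundle.proj (X := F)) X) (gamma X F) where
  comm _ := rfl
  linear f :=
    { map_add := by
        intro v w
        obtain ⟨v, rfl⟩ := (InternalTangentBundle.fibreEquiv f).symm.surjective v
        obtain ⟨w, rfl⟩ := (InternalTangentBundle.fibreEquiv f).symm.surjective w
        refine Fibre.ext (SmoothMap.ext (funext fun x => ?_))
        exact congrArg (InternalTangentBundle.mk _) (map_add (tangentMap _ _ _) v w)
      map_smul := by
        intro r v
        obtain ⟨v, rfl⟩ := (InternalTangentBundle.fibreEquiv f).symm.surjective v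
        refine Fibre.ext (SmoothMap.ext (funext fun x => ?_))
        exact congrArg (InternalTangentBundle.mk _) (map_smul (tangentMap _ _ _) r v) }
  dSmooth := dSmooth_curry_iff.2 <| dSmooth_iff_trivialization_comp.2 <| by
    simp only [trivialization_gamma]
    have h : DSmooth fun z : InternalTangentBundle (SmoothMap X F) × X =>
        trivialization (SmoothMap X F) z.1 := dSmooth_trivialization.comp dSmooth_id.fst
    exact (h.fst.smoothMap_apply dSmooth_id.snd).prodMk (h.snd.smoothMap_apply dSmooth_id.snd)
  inverse := by
    have h : DSmooth fun z : SmoothMap X (InternalTangentBundle F) × X =>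
        trivialization F (z.1 z.2) :=
      dSmooth_trivialization.comp (dSmooth_curry_iff.1 dSmooth_id)
    let a : SmoothMap X (InternalTangentBundle F) → SmoothMap X F × SmoothMap X F := fun g =>
      (⟨fun x => (trivialization F (g x)).1, (h.comp (dSmooth_const.prodMk dSmooth_id)).fst⟩,
        ⟨fun x => (trivialization F (g x)).2, (h.comp (dSmooth_const.prodMk dSmooth_id)).snd⟩)
    have ha : DSmooth a := (dSmooth_curry_iff.2 h.fst).prodMk (dSmooth_curry_iff.2 h.snd)
    refine ⟨fun g => (trivialization (SmoothMap X F)).symm (a g), ha.trivialization_symm,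
      fun z => ?_, fun g => SmoothMap.ext (funext fun x => (trivialization F).injective ?_)⟩
    · rw [Equiv.symm_apply_eq]
      refine Prod.ext (SmoothMap.ext (funext fun x => ?_)) (SmoothMap.ext (funext fun x => ?_))
      · exact congrArg Prod.fst (trivialization_gamma F z x)
      · exact congrArg Prod.snd (trivialization_gamma F z x)
    · refine (trivialization_gamma F _ x).trans ?_
      rw [Equiv.apply_symm_apply]

/-- In the trivializations, the natural map is the bijection `F^J × F^J ≃ (F × F)^J`. -/
theorem isDVSIso_powTangentMap (J : Type*) :
    IsDVSIso (InternalTangentBundle.proj (X := J → F))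
      (powMap (InternalTangentBundle.proj (X := F)) J) (powTangentMap J F) where
  comm _ := rfl
  linear f :=
    { map_add := by
        intro v w
        obtain ⟨v, rfl⟩ := (InternalTangentBundle.fibreEquiv f).symm.surjective v
        obtain ⟨w, rfl⟩ := (InternalTangentBundle.fibreEquiv f).symm.surjective w
        refine Fibre.ext (funext fun j => ?_)
        exact congrArg (InternalTangentBundle.mk _) (map_add (tangentMap _ _ _) v w)
      map_smul := by
        intro r v
        obtain ⟨v, rfl⟩ := (InternalTangentBundle.fibreEquiv f).symm.surjective v
        refine Fibre.ext (funext fun j => ?_)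
        exact congrArg (InternalTangentBundle.mk _) (map_smul (tangentMap _ _ _) r v) }
  dSmooth := dSmooth_pi_iff.2 fun j => dSmooth_iff_trivialization_comp.2 <| by
    simp only [trivialization_powTangentMap]
    have h := dSmooth_trivialization (F := J → F)
    exact (dSmooth_pi_iff.1 h.fst j).prodMk (dSmooth_pi_iff.1 h.snd j)
  inverse := by
    have h : ∀ j, DSmooth fun g : J → InternalTangentBundle F => trivialization F (g j) := fun j =>
      dSmooth_trivialization.comp (dSmooth_pi_iff.1 dSmooth_id j)
    let a : (J → InternalTangentBundle F) → (J → F) × (J → F) := fun g =>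
      (fun j => (trivialization F (g j)).1, fun j => (trivialization F (g j)).2)
    have ha : DSmooth a :=
      (dSmooth_pi_iff.2 fun j => (h j).fst).prodMk (dSmooth_pi_iff.2 fun j => (h j).snd)
    refine ⟨fun g => (trivialization (J → F)).symm (a g), ha.trivialization_symm,
      fun z => ?_, fun g => funext fun j => (trivialization F).injective ?_⟩
    · rw [Equiv.symm_apply_eq]
      refine Prod.ext (funext fun j => ?_) (funext fun j => ?_)
      · exact congrArg Prod.fst (trivialization_powTangentMap F z j)
      · exact congrArg Prod.snd (trivialization_powTangentMap F z j)
    · refine (trivialization_powTangentMap F _ j).trans ?_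
      rw [Equiv.apply_symm_apply]

end Natural

end Diffeology

open Diffeology in
theorem mainTheorem6 (n : ℕ) (X : Type*) [DiffeologicalSpace X] (J : Type*) :
    -- Hector's diffeology and the dvs diffeology agree on all tangent bundles involved
    hectorDiffeology (Euc n) = dvsDiffeology (Euc n) ∧
    hectorDiffeology (SmoothMap X (Euc n)) = dvsDiffeology (SmoothMap X (Euc n)) ∧
    hectorDiffeology (J → Euc n) = dvsDiffeology (J → Euc n) ∧
    -- function spaces
    (IsDVSOver (InternalTangentBundle.proj (X := SmoothMap X (Euc n))) ∧
      IsDVSOver (postcomp (InternalTangentBundle.proj (X := Euc n)) X) ∧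
      IsDVSIso (InternalTangentBundle.proj (X := SmoothMap X (Euc n)))
        (postcomp (InternalTangentBundle.proj (X := Euc n)) X) (gamma X (Euc n))) ∧
    -- products
    (IsDVSOver (InternalTangentBundle.proj (X := J → Euc n)) ∧
      IsDVSOver (powMap (InternalTangentBundle.proj (X := Euc n)) J) ∧
      IsDVSIso (InternalTangentBundle.proj (X := J → Euc n))
        (powMap (InternalTangentBundle.proj (X := Euc n)) J) (powTangentMap J (Euc n))) := by
  exact ⟨hectorDiffeology_eq_dvsDiffeology _, hectorDiffeology_eq_dvsDiffeology _,
    hectorDiffeology_eq_dvsDiffeology _,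
    ⟨inferInstance, inferInstance, isDVSIso_gamma _ X⟩,
    ⟨inferInstance, inferInstance, isDVSIso_powTangentMap _ J⟩⟩
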